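/- Consider $N\ge 1$ identical machines and finitely many (at least one) jobs arriving online. Job $i$ has a release date $r_i\ge 0$ and finitely many (at least one) tasks with positive processing times $p_i^{(\ell)}$, each marked preemptive or non-preemptive; $p_i=\sum_\ell p_i^{(\ell)}$ is its workload. A feasible schedule serves no task before the release date of its job, serves each task on at most one machine at a time and each machine serves at most one task at a time, gives each task exactly its processing time within finite time, and runs every non-preemptive task without interruption on one machine. Fix one of two scenarios: different tasks of the same job may, or may not, be processed simultaneously. The cost of a schedule is the total response time $\sum_i (C_i-r_i)$, where $C_i$ is the time at which the last task of job $i$ is completed, and $\mathrm{OPT}(\omega)$ is the infimum of the cost over all feasible schedules of the instance $\omega$. An online algorithm $\mathcal A$ assigns to every instance a feasible schedule whose action at each time $t$ depends only on the jobs released up to time $t$ (with all data of these jobs). For an instance $\omega$ let $\alpha(\omega)=\max_i p_i/\min_i p_i$ and $\beta(\omega)=\eta/\min_i p_i$, where $\eta$ is the maximum processing time of a non-preemptive task ($\eta=0$ if there is none), so that $\alpha(\omega)\ge 1$ and $0\le\beta(\omega)\le\alpha(\omega)$. For $\alpha\ge1$ and $0\le\beta\le\alpha$ put $$\mathcal{CR}_{\mathcal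 A}(\alpha,\beta)=\sup\Big\{\frac{\mathrm{Cost}_{\mathcal A}(\omega)}{\mathrm{OPT}(\omega)}\;:\;\alpha(\omega)=\alpha,\ \beta(\omega)=\beta\Big\}\in[0,\infty].$$ Then, in either scenario and for every number $N\ge1$ of machines: 1. No online algorithm has competitive ratio $o(\log\alpha+\beta)$; that is, for no online algorithm $\mathcal A$ is it true that for every $\varepsilon>0$ there is $M$ such that $\mathcal{CR}_{\mathcal A}(\alpha,\beta)\le\varepsilon(\log\alpha+\beta)$ for all $\alpha\ge 1$, $0\le\beta\le\alpha$ with $\log\alpha+\beta\ge M$. 2. There is a constant $c>0$, depending only on $N$ and the scenario, such that $\mathcal{CR}_{\mathcal A}(\alpha,\beta)\ge c\,\beta$ for every online algorithm $\mathcal A$ and all $\alpha\ge1$, $0\le\beta\le\alpha$. 3. If $N\ge2$, there is a constant $c>0$, depending only on $N$ and the scenario, such that $\mathcal{CR}_{\mathcal A}(\alpha,\beta)\ge c\,(\log\alpha+\beta)$ for every online algorithm $\mathcal A$ and all $\alpha\ge1$, $0\le\beta\le\alpha$. -/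

import Mathlib

open MeasureTheory Set
open scoped ENNReal

namespace MultitaskScheduling

/-- A task: a positive processing time, and whether it may be preempted. -/
structure Task where
  size : ℝ
  size_pos : 0 < size
  preemptive : Bool

/-- A job: a release date and a nonempty list of tasks. -/
structure Job where
  release : ℝ
  release_nonneg : 0 ≤ release
  tasks : List Task
  tasks_ne_nil : tasks ≠ []

/-- The workload of a job is the total processing time of its tasks. -/
noncomputable def Job.workload (J : Job) : ℝ := (J.tasks.map Task.size).sum

/-- An input instance: a nonempty finite sequence of jobs, listed in order of release
(jobs with the same release date are listed in an arbitrary order). -/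
structure Instance where
  jobs : List Job
  jobs_ne_nil : jobs ≠ []
  sorted : jobs.Pairwise (fun J K => J.release ≤ K.release)

namespace Instance

/-- `τ` is task number `l` of the job `J`, which is job number `j` of the instance. -/
def IsTask (ω : Instance) (j l : ℕ) (J : Job) (τ : Task) : Prop :=
  ω.jobs[j]? = some J ∧ J.tasks[l]? = some τ

/-- The maximum job workload. -/
noncomputable def maxWorkload (ω : Instance) : ℝ :=
  sSup {x : ℝ | ∃ J ∈ ω.jobs, x = J.workload}

/-- The minimum job workload. -/
noncomputable def minWorkload (ω : Instance) : ℝ :=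
  sInf {x : ℝ | ∃ J ∈ ω.jobs, x = J.workload}

/-- The maximum processing time `η` of a non-preemptive task
(`0` if there is no such task, since `sSup ∅ = 0`). -/
noncomputable def eta (ω : Instance) : ℝ :=
  sSup {x : ℝ | ∃ J ∈ ω.jobs, ∃ τ ∈ J.tasks, τ.preemptive = false ∧ x = τ.size}

/-- `α`, the ratio of the maximum to the minimum job workload. -/
noncomputable def alpha (ω : Instance) : ℝ := ω.maxWorkload / ω.minWorkload

/-- `β = η / (minimum job workload)`. -/
noncomputable def beta (ω : Instance) : ℝ := ω.eta / ω.minWorkload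

open Classical in
/-- The information available at time `t`: the jobs released up to time `t`, with all their data.
As the jobs are listed by release date, this is an initial segment of the list of jobs. -/
noncomputable def revealed (ω : Instance) (t : ℝ) : List Job :=
  ω.jobs.filter (fun J => decide (J.release ≤ t))

end Instance

/-- A schedule on `N` identical machines says, for each time and each machine, which task the
machine is processing: `some (j, l)` is task `l` of job `j`, and `none` means idle. -/
abbrev Schedule (N : ℕ) := ℝ → Fin N → Option (ℕ × ℕ)

/-- The set of times at which task `l` of job `j` is in service. -/
def Schedule.serviceTimes {N : ℕ} (σ : Schedule N) (j l : ℕ) : Set ℝ :=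
  {t | ∃ m, σ t m = some (j, l)}

/-- Feasibility of a schedule for an instance. If `par` holds, then different tasks of the same job
may be processed at the same time; otherwise they may not. -/
structure Schedule.Feasible {N : ℕ} (par : Prop) (ω : Instance) (σ : Schedule N) : Prop where
  measurable : ∀ m j l, MeasurableSet {t | σ t m = some (j, l)}
  /-- only tasks of the instance are processed, and not before the release date -/
  released : ∀ t m j l, σ t m = some (j, l) → ∃ J τ, ω.IsTask j l J τ ∧ J.release ≤ t
  /-- a task is processed by at most one machine at a time -/
  no_split : ∀ t m m' j l, σ t m = some (j, l) → σ t m' = some (j, l) → m = m'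
  /-- if tasks of one job may not run in parallel, at most one machine at a time serves a job -/
  no_parallel : ¬ par → ∀ t m m' j l l',
    σ t m = some (j, l) → σ t m' = some (j, l') → m = m'
  /-- each task receives exactly its processing time -/
  total : ∀ j l J τ, ω.IsTask j l J τ → volume (σ.serviceTimes j l) = ENNReal.ofReal τ.size
  /-- each task is finished at some finite time -/
  finishes : ∀ j l J τ, ω.IsTask j l J τ → ∃ T : ℝ, ∀ t ∈ σ.serviceTimes j l, t < T
  /-- a non-preemptive task is run to completion, without interruption, on one machine -/
  nonpreemptive : ∀ j l J τ, ω.IsTask j l J τ → τ.preemptive = false →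
    ∃ (m : Fin N) (s : ℝ), ∀ t m', σ t m' = some (j, l) ↔ m' = m ∧ t ∈ Ico s (s + τ.size)

/-- The amount of processing that task `l` of job `j` has received up to time `t`. -/
noncomputable def Schedule.work {N : ℕ} (σ : Schedule N) (j l : ℕ) (t : ℝ) : ℝ :=
  (volume (σ.serviceTimes j l ∩ Iic t)).toReal

/-- Completion time of the task `τ`, number `l` in job `j`: the first time at which it has received
its full processing time. -/
noncomputable def Schedule.taskCompletion {N : ℕ} (σ : Schedule N) (j l : ℕ) (τ : Task) : ℝ :=
  sInf {t : ℝ | τ.size ≤ σ.work j l t}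

/-- Completion time of the job `J`, number `j`: the maximum completion time of its tasks. -/
noncomputable def Schedule.jobCompletion {N : ℕ} (σ : Schedule N) (j : ℕ) (J : Job) : ℝ :=
  sSup {c : ℝ | ∃ l τ, J.tasks[l]? = some τ ∧ c = σ.taskCompletion j l τ}

/-- The cost of a schedule: the total response time `∑ j, (C j - r j)`. -/
noncomputable def Schedule.cost {N : ℕ} (ω : Instance) (σ : Schedule N) : ℝ :=
  ∑ j : Fin ω.jobs.length, (σ.jobCompletion j (ω.jobs.get j) - (ω.jobs.get j).release)

/-- The optimal offline cost of an instance on `N` machines. -/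
noncomputable def opt (N : ℕ) (par : Prop) (ω : Instance) : ℝ :=
  sInf {c : ℝ | ∃ σ : Schedule N, σ.Feasible par ω ∧ c = σ.cost ω}

/-- A (deterministic) online algorithm: it produces a feasible schedule for each instance, and what
it does at time `t` depends only on the jobs released up to time `t`. -/
structure OnlineAlgorithm (N : ℕ) (par : Prop) where
  schedule : Instance → Schedule N
  feasible : ∀ ω, (schedule ω).Feasible par ω
  causal : ∀ ω ω' t, ω.revealed t = ω'.revealed t → schedule ω t = schedule ω' t

namespace OnlineAlgorithm

variable {N : ℕ} {par : Prop}

/-- The competitive ratio as a function of the parameters: the worst ratio of the cost of the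
algorithm to the optimal offline cost, over the instances with parameters `α` and `β`. -/
noncomputable def competitiveRatio (A : OnlineAlgorithm N par) (α β : ℝ) : ℝ≥0∞ :=
  ⨆ (ω : Instance) (_ : ω.alpha = α ∧ ω.beta = β),
    ENNReal.ofReal ((A.schedule ω).cost ω / opt N par ω)

/-- The competitive ratio is `o(log α + β)`: for every `ε > 0` it is at most `ε * (log α + β)` as
soon as `log α + β` is large (the possible parameters being those with `1 ≤ α`, `0 ≤ β ≤ α`). -/
def IsLittleOCompetitive (A : OnlineAlgorithm N par) : Prop :=
  ∀ ε : ℝ, 0 < ε → ∃ M : ℝ, ∀ α β : ℝ, 1 ≤ α → 0 ≤ β → β ≤ α → M ≤ Real.log α + β →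
    A.competitiveRatio α β ≤ ENNReal.ofReal (ε * (Real.log α + β))

end OnlineAlgorithm

end MultitaskScheduling

/-! The proof is an adversary argument. A stream of `N` unit jobs per unit of time uses the whole
capacity of the `N` machines. Hence a backlog of `V` jobs present when the stream starts, or created
by diverting machine time to another job, can never shrink. Over `K` rounds it costs about `K * V`
(`Feasible.mul_le_cost_of_rounds`). An offline schedule that meets the stream without backlog pays
only `O(N * K)`, so for large `K` the ratio is of order `V / N`.

For the bound in `β`, a lone job with a non-preemptive task of length `β` is released. The algorithm
must start this task at some time `s`. The stream then begins at `s + 1`, which by causality is too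
late for the algorithm to react, and one machine stays blocked for `β - 1` more units. Offline, the
big job is run before or after the stream. Taking `α = β` also refutes `o(log α + β)`.

For the bound in `log α`, phases of geometrically decreasing length are used. Phase `i` has a long
job of size `2 * h`, where `h = halfPhase M i`, and a stream during its first half. If the algorithm
gives a long job at least `I` units during a first half, the stream of that phase is prolonged and a
backlog of `I` persists. Otherwise each of the first `I` long jobs is too far behind to finish
before phase `I`, and the stream starting there meets `I` unfinished jobs. With two machines an
offline schedule completes every phase in time, by reserving machine `0` for the long job
(`exists_placement_phases`). About `log α` phases fit under the size limit `α`.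

Both scenarios are treated at once: the lower bounds use only capacity and causality, and the
offline schedules run each job sequentially on one machine. -/

namespace MultitaskScheduling

/-! ### Work received, completion times and cost -/

namespace Schedule

variable {N : ℕ} {par : Prop} {ω : Instance} {σ : Schedule N}

theorem serviceTimes_eq_iUnion (σ : Schedule N) (j l : ℕ) :
    σ.serviceTimes j l = ⋃ m, {t | σ t m = some (j, l)} := by
  ext t; simp [serviceTimes]

theorem Feasible.measurableSet_serviceTimes (hσ : σ.Feasible par ω) (j l : ℕ) :
    MeasurableSet (σ.serviceTimes j l) := by
  rw [serviceTimes_eq_iUnion]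
  exact MeasurableSet.iUnion fun m => hσ.measurable m j l

theorem Feasible.volume_serviceTimes_ne_top (hσ : σ.Feasible par ω) (j l : ℕ) :
    volume (σ.serviceTimes j l) ≠ ∞ := by
  by_cases h : ∃ J τ, ω.IsTask j l J τ
  · obtain ⟨J, τ, h⟩ := h
    rw [hσ.total j l J τ h]
    exact ENNReal.ofReal_ne_top
  · have : σ.serviceTimes j l = ∅ := by
      ext t
      simp only [serviceTimes, mem_ofPred_eq, mem_empty_iff_false, iff_false]
      rintro ⟨m, hm⟩
      obtain ⟨J, τ, hJ, -⟩ := hσ.released t m j l hm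
      exact h ⟨J, τ, hJ⟩
    simp [this]

theorem Feasible.work_sub_work (hσ : σ.Feasible par ω) (j l : ℕ) {a b : ℝ} (hab : a ≤ b) :
    σ.work j l b - σ.work j l a = volume.real (σ.serviceTimes j l ∩ Ioc a b) := by
  have hfin := hσ.volume_serviceTimes_ne_top j l
  have hsplit : σ.serviceTimes j l ∩ Iic b =
      (σ.serviceTimes j l ∩ Iic a) ∪ (σ.serviceTimes j l ∩ Ioc a b) := by
    rw [← inter_union_distrib_left, Iic_union_Ioc_eq_Iic hab]
  have hdisj : Disjoint (σ.serviceTimes j l ∩ Iic a) (σ.serviceTimes j l ∩ Ioc a b) :=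
    (Iic_disjoint_Ioc le_rfl).mono inter_subset_right inter_subset_right
  have h := measureReal_union hdisj
    ((hσ.measurableSet_serviceTimes j l).inter measurableSet_Ioc) (μ := volume)
    (measure_ne_top_of_subset inter_subset_left hfin)
    (measure_ne_top_of_subset inter_subset_left hfin)
  rw [← hsplit] at h
  simp only [work, ← Measure.real_def] at *
  linarith

theorem Feasible.work_mono (hσ : σ.Feasible par ω) (j l : ℕ) : Monotone (σ.work j l) := by
  intro a b hab
  have := hσ.work_sub_work j l hab
  have : 0 ≤ volume.real (σ.serviceTimes j l ∩ Ioc a b) := measureReal_nonneg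
  linarith

theorem Feasible.work_sub_le (hσ : σ.Feasible par ω) (j l : ℕ) {a b : ℝ} (hab : a ≤ b) :
    σ.work j l b - σ.work j l a ≤ b - a := by
  rw [hσ.work_sub_work j l hab]
  calc volume.real (σ.serviceTimes j l ∩ Ioc a b) ≤ volume.real (Ioc a b) :=
        measureReal_mono inter_subset_right (by simp)
    _ = b - a := by simp [hab]

theorem Feasible.work_eq_zero (hσ : σ.Feasible par ω) {j l : ℕ} {J : Job} {τ : Task}
    (h : ω.IsTask j l J τ) {t : ℝ} (ht : t ≤ J.release) : σ.work j l t = 0 := by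
  -- Service at the release date itself is allowed, so the set need not be empty, but it is null.
  have hsub : σ.serviceTimes j l ∩ Iic t ⊆ {t} := by
    rintro u ⟨⟨m, hm⟩, hu⟩
    obtain ⟨J', τ', h', hr⟩ := hσ.released u m j l hm
    obtain rfl : J = J' := by
      have := h.1.symm.trans h'.1
      simpa using this
    exact le_antisymm hu (ht.trans hr)
  have : volume (σ.serviceTimes j l ∩ Iic t) = 0 :=
    measure_mono_null hsub (by simp)
  simp [work, this]

theorem Feasible.work_eventually_eq_size (hσ : σ.Feasible par ω) {j l : ℕ} {J : Job} {τ : Task}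
    (h : ω.IsTask j l J τ) : ∃ T, σ.work j l T = τ.size := by
  obtain ⟨T, hT⟩ := hσ.finishes j l J τ h
  refine ⟨T, ?_⟩
  have : σ.serviceTimes j l ∩ Iic T = σ.serviceTimes j l :=
    inter_eq_left.2 fun t ht => (hT t ht).le
  rw [work, this, hσ.total j l J τ h, ENNReal.toReal_ofReal τ.size_pos.le]

/-- The capacity bound: a machine serves distinct jobs at disjoint times. One task index suffices,
since the adversary arguments track only task `0` of each job. -/
theorem Feasible.sum_work_sub_le (hσ : σ.Feasible par ω) (S : Finset ℕ) (l : ℕ) {a b : ℝ}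
    (hab : a ≤ b) :
    ∑ j ∈ S, (σ.work j l b - σ.work j l a) ≤ N * (b - a) := by
  have key : ∑ j ∈ S, volume (σ.serviceTimes j l ∩ Ioc a b) ≤ ENNReal.ofReal (N * (b - a)) := by
    calc ∑ j ∈ S, volume (σ.serviceTimes j l ∩ Ioc a b)
        ≤ ∑ j ∈ S, ∑ m : Fin N, volume ({t | σ t m = some (j, l)} ∩ Ioc a b) := by
          refine Finset.sum_le_sum fun j _ => ?_
          rw [serviceTimes_eq_iUnion, iUnion_inter]
          exact measure_iUnion_fintype_le _ _
      _ = ∑ m : Fin N, ∑ j ∈ S, volume ({t | σ t m = some (j, l)} ∩ Ioc a b) := Finset.sum_comm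
      _ ≤ ∑ _m : Fin N, ENNReal.ofReal (b - a) := by
          refine Finset.sum_le_sum fun m _ => ?_
          rw [← measure_biUnion_finset]
          · rw [← Real.volume_Ioc]
            exact measure_mono (iUnion₂_subset fun j _ => inter_subset_right)
          · intro j _ j' _ hjj'
            refine Disjoint.mono inter_subset_left inter_subset_left ?_
            rw [Set.disjoint_left]
            intro t ht ht'
            simp only [mem_ofPred_eq] at ht ht'
            rw [ht] at ht'
            simp only [Option.some.injEq, Prod.mk.injEq, and_true] at ht'
            exact hjj' ht'
          · exact fun j _ => (hσ.measurable m j l).inter measurableSet_Ioc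
      _ = ENNReal.ofReal (N * (b - a)) := by
          rw [ENNReal.ofReal_mul (by positivity)]
          simp
  have h2 : ∑ j ∈ S, (σ.work j l b - σ.work j l a) =
      (∑ j ∈ S, volume (σ.serviceTimes j l ∩ Ioc a b)).toReal := by
    rw [ENNReal.toReal_sum fun j _ => measure_ne_top_of_subset inter_subset_left
      (hσ.volume_serviceTimes_ne_top j l)]
    exact Finset.sum_congr rfl fun j _ => hσ.work_sub_work j l hab
  rw [h2]
  refine ENNReal.toReal_le_of_le_ofReal (mul_nonneg (by positivity) (by linarith)) key

theorem Feasible.le_taskCompletion (hσ : σ.Feasible par ω) {j l : ℕ} {J : Job} {τ : Task}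
    (h : ω.IsTask j l J τ) {t : ℝ} (ht : σ.work j l t < τ.size) :
    t ≤ σ.taskCompletion j l τ := by
  obtain ⟨T, hT⟩ := hσ.work_eventually_eq_size h
  refine le_csInf ⟨T, hT.ge⟩ fun u hu => ?_
  by_contra! hlt
  exact absurd (hσ.work_mono j l hlt.le) (not_le.2 (ht.trans_le hu))

theorem Feasible.le_jobCompletion (hσ : σ.Feasible par ω) {j l : ℕ} {J : Job} {τ : Task}
    (h : ω.IsTask j l J τ) {t : ℝ} (ht : σ.work j l t < τ.size) :
    t ≤ σ.jobCompletion j J := by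
  refine (hσ.le_taskCompletion h ht).trans (le_csSup ?_ ⟨l, τ, h.2, rfl⟩)
  have hsub : {c : ℝ | ∃ l τ, J.tasks[l]? = some τ ∧ c = σ.taskCompletion j l τ} ⊆
      (fun l => (J.tasks[l]?).elim 0 (σ.taskCompletion j l)) '' Set.Iio J.tasks.length := by
    rintro c ⟨l, τ, hl, rfl⟩
    exact ⟨l, (List.getElem?_eq_some_iff.1 hl).1, by simp [hl]⟩
  exact (((Set.finite_Iio _).image _).subset hsub).bddAbove

theorem Feasible.release_add_size_le_jobCompletion (hσ : σ.Feasible par ω) {j l : ℕ} {J : Job}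
    {τ : Task} (h : ω.IsTask j l J τ) : J.release + τ.size ≤ σ.jobCompletion j J := by
  refine le_of_forall_lt_imp_le_of_dense fun t ht => hσ.le_jobCompletion h ?_
  rcases le_total t J.release with hr | hr
  · rw [hσ.work_eq_zero h hr]
    exact τ.size_pos
  · have := hσ.work_sub_le j l hr
    rw [hσ.work_eq_zero h le_rfl] at this
    linarith

theorem Feasible.release_le_jobCompletion (hσ : σ.Feasible par ω) {j : ℕ} {J : Job}
    (h : ω.jobs[j]? = some J) : J.release ≤ σ.jobCompletion j J := by
  obtain ⟨τ, ts, hτ⟩ := List.exists_cons_of_ne_nil J.tasks_ne_nil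
  have := hσ.release_add_size_le_jobCompletion (j := j) (l := 0) (J := J) (τ := τ)
    ⟨h, by simp [hτ]⟩
  linarith [τ.size_pos]

theorem Feasible.sum_le_cost (hσ : σ.Feasible par ω) (F : Finset ℕ) (g : ℕ → ℝ)
    (h : ∀ j ∈ F, ∃ J, ω.jobs[j]? = some J ∧ g j ≤ σ.jobCompletion j J - J.release) :
    ∑ j ∈ F, g j ≤ σ.cost ω := by
  set f : ℕ → ℝ := fun j =>
    (ω.jobs[j]?).elim 0 (fun J => σ.jobCompletion j J - J.release) with hf
  have hcost : σ.cost ω = ∑ j ∈ Finset.range ω.jobs.length, f j := by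
    rw [Finset.sum_range, cost]
    exact Finset.sum_congr rfl fun j _ => by simp [hf]
  rw [hcost]
  calc ∑ j ∈ F, g j ≤ ∑ j ∈ F, f j := by
        refine Finset.sum_le_sum fun j hj => ?_
        obtain ⟨J, hJ, hg⟩ := h j hj
        simpa [hf, hJ] using hg
    _ ≤ ∑ j ∈ Finset.range ω.jobs.length, f j := by
        refine Finset.sum_le_sum_of_subset_of_nonneg (fun j hj => ?_) fun j hj _ => ?_
        · obtain ⟨J, hJ, -⟩ := h j hj
          simpa using (List.getElem?_eq_some_iff.1 hJ).1
        · have hj' := List.getElem?_eq_getElem (Finset.mem_range.1 hj)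
          simp only [hf, hj', Option.elim_some]
          linarith [hσ.release_le_jobCompletion hj']

/-- The bound is uniform in the schedule, so the infimum `opt` is over a set bounded below and is
positive, and division by it is legitimate. -/
theorem exists_pos_le_cost (ω : Instance) : ∃ x : ℝ, 0 < x ∧
    ∀ {N : ℕ} {par : Prop} {σ : Schedule N}, σ.Feasible par ω → x ≤ σ.cost ω := by
  obtain ⟨J, Js, hJ⟩ := List.exists_cons_of_ne_nil ω.jobs_ne_nil
  obtain ⟨τ, τs, hτ⟩ := List.exists_cons_of_ne_nil J.tasks_ne_nil
  refine ⟨τ.size, τ.size_pos, fun {N par σ} hσ => ?_⟩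
  have := hσ.sum_le_cost {0} (fun _ => τ.size) (by
    have h0 : ω.IsTask 0 0 J τ := ⟨by simp [hJ], by simp [hτ]⟩
    intro j hj
    obtain rfl := Finset.mem_singleton.1 hj
    exact ⟨J, h0.1, by linarith [hσ.release_add_size_le_jobCompletion h0]⟩)
  simpa using this

/-- The work received up to time `T` is determined by the schedule before `T`. -/
theorem work_congr {σ σ' : Schedule N} {T : ℝ} (h : ∀ t < T, σ t = σ' t) (j l : ℕ) :
    σ.work j l T = σ'.work j l T := by
  have aux : ∀ ρ : Schedule N,
      volume (ρ.serviceTimes j l ∩ Iic T) = volume (ρ.serviceTimes j l ∩ Iio T) := fun ρ =>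
    measure_congr ((ae_eq_refl _).inter Iio_ae_eq_Iic.symm)
  have : σ.serviceTimes j l ∩ Iio T = σ'.serviceTimes j l ∩ Iio T := by
    ext t
    simp only [serviceTimes, mem_inter_iff, mem_ofPred_eq, mem_Iio]
    exact and_congr_left fun ht => by rw [h t ht]
  rw [work, work, aux, aux, this]

end Schedule

theorem opt_le_cost {N : ℕ} {par : Prop} {ω : Instance} {σ : Schedule N}
    (hσ : σ.Feasible par ω) : opt N par ω ≤ σ.cost ω := by
  obtain ⟨x, -, hx⟩ := Schedule.exists_pos_le_cost ω
  refine csInf_le ⟨x, ?_⟩ ⟨σ, hσ, rfl⟩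
  rintro c ⟨σ', hσ', rfl⟩
  exact hx hσ'

theorem opt_pos {N : ℕ} {par : Prop} {ω : Instance} {σ : Schedule N}
    (hσ : σ.Feasible par ω) : 0 < opt N par ω := by
  obtain ⟨x, hx0, hx⟩ := Schedule.exists_pos_le_cost ω
  refine hx0.trans_le (le_csInf ⟨_, σ, hσ, rfl⟩ ?_)
  rintro c ⟨σ', hσ', rfl⟩
  exact hx hσ'

theorem OnlineAlgorithm.le_competitiveRatio {N : ℕ} {par : Prop} (A : OnlineAlgorithm N par)
    {α β x y c : ℝ} {ω : Instance} (hα : ω.alpha = α) (hβ : ω.beta = β)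
    (hcost : x ≤ (A.schedule ω).cost ω) (hopt : opt N par ω ≤ y) (hxy : c * y ≤ x)
    (hc : 0 ≤ c) : ENNReal.ofReal c ≤ A.competitiveRatio α β := by
  refine le_iSup₂_of_le ω ⟨hα, hβ⟩ (ENNReal.ofReal_le_ofReal ?_)
  rw [le_div_iff₀ (opt_pos (A.feasible ω))]
  exact (mul_le_mul_of_nonneg_left hopt hc).trans (hxy.trans hcost)

theorem OnlineAlgorithm.one_le_competitiveRatio {N : ℕ} {par : Prop} (A : OnlineAlgorithm N par)
    {α β : ℝ} {ω : Instance} (hα : ω.alpha = α) (hβ : ω.beta = β) :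
    ENNReal.ofReal 1 ≤ A.competitiveRatio α β :=
  A.le_competitiveRatio hα hβ le_rfl (opt_le_cost (A.feasible ω)) (by simp) zero_le_one

/-! ### Persistence of a backlog under a saturating stream -/

namespace Schedule

variable {N : ℕ} {par : Prop} {ω : Instance} {σ : Schedule N}

/-- A job with at least one unit of work of one task left at time `r` has response time at least
the sum over integer times of the part of this unit which is still left. -/
theorem Feasible.sum_remaining_le_response (hσ : σ.Feasible par ω) {j : ℕ} {J : Job} {τ : Task}
    (h : ω.IsTask j 0 J τ) {r : ℝ} {κ : ℕ} (hr : J.release ≤ r + κ)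
    (hrem : 1 ≤ τ.size - σ.work j 0 r) (S : Finset ℕ) :
    ∑ k ∈ S with κ < k, (1 - (σ.work j 0 (r + k) - σ.work j 0 r)) ≤
      σ.jobCompletion j J - J.release := by
  set C := σ.jobCompletion j J with hC
  calc ∑ k ∈ S with κ < k, (1 - (σ.work j 0 (r + k) - σ.work j 0 r))
      ≤ ∑ k ∈ S with κ < k, (if r + k ≤ C then 1 else 0) := by
        refine Finset.sum_le_sum fun k _ => ?_
        split_ifs with hk
        · linarith [hσ.work_mono j 0 (show r ≤ r + k by simp)]
        · by_contra! hlt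
          exact hk (hσ.le_jobCompletion h (by linarith))
    _ = ((({k ∈ S | κ < k}).filter fun k : ℕ => r + k ≤ C).card : ℝ) := by simp
    -- The response time dominates the number of integer times `r + k ≤ C` with `k > κ`, because the
    -- release is at most `r + κ`.
    _ ≤ ((Finset.Ioc κ ⌊C - r⌋₊).card : ℝ) := by
        refine Nat.cast_le.2 (Finset.card_le_card fun k hk => ?_)
        simp only [Finset.mem_filter, Finset.mem_Ioc] at hk ⊢
        exact ⟨hk.1.2, Nat.le_floor (by linarith [hk.2])⟩
    _ ≤ C - J.release := by
        rw [Nat.card_Ioc]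
        have h0 := hσ.release_le_jobCompletion h.1
        rcases le_total ⌊C - r⌋₊ κ with hκ | hκ
        · rw [Nat.sub_eq_zero_of_le hκ]
          simpa using h0
        · rw [Nat.cast_sub hκ]
          rcases le_total 0 (C - r) with h1 | h1
          · linarith [Nat.floor_le h1]
          · rw [Nat.floor_of_nonpos h1]
            have : (0:ℝ) ≤ κ := by positivity
            simp only [Nat.cast_zero]
            linarith

/-- Suppose that `N` unit jobs are released at each of the times `r, r + 1, …, r + b - 1`. If the
number of other jobs with at least one unit of work left at time `r`, plus the work spent on another
job between the times `r` and `r + a`, is at least `V`, then there are always at least `V`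
unfinished jobs between the times `r + a` and `r + b`. -/
theorem Feasible.mul_le_cost_of_rounds (hσ : σ.Feasible par ω) (hN : 0 < N) {n : ℕ} {r : ℝ}
    {a b : ℕ} {V : ℝ} (hab : a ≤ b)
    (hrounds : ∀ q < N * b, ∃ J τ, ω.IsTask (n + q) 0 J τ ∧ τ.size = 1 ∧
      J.release = r + (q / N : ℕ))
    (G : Finset ℕ) (hG : ∀ j ∈ G, j < n ∧ ∃ J τ, ω.IsTask j 0 J τ ∧ J.release ≤ r ∧
      1 ≤ τ.size - σ.work j 0 r)
    {j₀ : ℕ} (hj₀ : j₀ < n) (hj₀G : j₀ ∉ G)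
    (hV : V ≤ G.card + (σ.work j₀ 0 (r + a) - σ.work j₀ 0 r)) :
    ((b : ℝ) - a) * V ≤ σ.cost ω := by
  -- The round of a stream job. On `G` the subtraction truncates to `0`, so these jobs are counted
  -- at every `k ≥ 1`.
  set κ : ℕ → ℕ := fun j => (j - n) / N with hκ
  set F : ℕ → Finset ℕ := fun k => G ∪ Finset.Ico n (n + N * k) with hF
  set g : ℕ → ℕ → ℝ := fun j k => 1 - (σ.work j 0 (r + k) - σ.work j 0 r) with hg
  have hFk : ∀ k ∈ Finset.Ioc a b, {j ∈ F b | κ j < k} = F k := by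
    intro k hk
    rw [Finset.mem_Ioc] at hk
    have hkb : N * k ≤ N * b := Nat.mul_le_mul_left _ hk.2
    ext j
    simp only [hF, hκ, Finset.mem_filter, Finset.mem_union, Finset.mem_Ico,
      Nat.div_lt_iff_lt_mul hN, mul_comm k N]
    constructor
    · rintro ⟨h1 | h1, h2⟩
      · exact Or.inl h1
      · right; omega
    · rintro (h1 | h1)
      · refine ⟨Or.inl h1, ?_⟩
        have := (hG j h1).1
        have : 0 < N * k := Nat.mul_pos hN (by omega)
        omega
      · refine ⟨Or.inr ?_, ?_⟩ <;> omega
  have hcount : ∀ k ∈ Finset.Ioc a b, V ≤ ∑ j ∈ F k, g j k := by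
    intro k hk
    have hk' := Finset.mem_Ioc.1 hk
    have hdisj : Disjoint G (Finset.Ico n (n + N * k)) := by
      rw [Finset.disjoint_left]
      intro j hj hj'
      have := (hG j hj).1
      rw [Finset.mem_Ico] at hj'
      omega
    have hj₀F : j₀ ∉ F k := by
      simp only [hF, Finset.mem_union, Finset.mem_Ico, not_or]
      exact ⟨hj₀G, by omega⟩
    -- Up to `r + k` the jobs in `F k` account for `G.card + N * k` units, while the machines supply
    -- at most `N * k`, part of which went to `j₀`.
    have hcap := hσ.sum_work_sub_le (insert j₀ (F k)) 0 (show r ≤ r + k by simp)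
    rw [Finset.sum_insert hj₀F] at hcap
    have hcard : ((F k).card : ℝ) = G.card + N * k := by
      rw [hF, Finset.card_union_of_disjoint hdisj]
      simp
    have hak : (a : ℝ) ≤ k := by exact_mod_cast hk'.1.le
    have hmono := hσ.work_mono j₀ 0 (show r + a ≤ r + k by linarith)
    simp only [hg, Finset.sum_sub_distrib, Finset.sum_const, nsmul_eq_mul, mul_one] at hcap ⊢
    rw [hcard]
    have : (N : ℝ) * (r + k - r) = N * k := by ring
    linarith
  calc ((b : ℝ) - a) * V = ∑ k ∈ Finset.Ioc a b, V := by
        simp [Nat.cast_sub hab]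
    _ ≤ ∑ k ∈ Finset.Ioc a b, ∑ j ∈ F b with κ j < k, g j k := by
        refine Finset.sum_le_sum fun k hk => ?_
        rw [hFk k hk]
        exact hcount k hk
    _ = ∑ j ∈ F b, ∑ k ∈ Finset.Ioc a b with κ j < k, g j k := by
        simp only [Finset.sum_filter]
        exact Finset.sum_comm
    _ ≤ σ.cost ω := by
        refine hσ.sum_le_cost _ _ fun j hj => ?_
        rcases Finset.mem_union.1 hj with hj | hj
        · obtain ⟨-, J, τ, hJ, hr, hrem⟩ := hG j hj
          exact ⟨J, hJ.1, hσ.sum_remaining_le_response hJ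
            (hr.trans (by simp)) hrem _⟩
        · rw [Finset.mem_Ico] at hj
          obtain ⟨J, τ, hJ, hτ, hr⟩ := hrounds (j - n) (by omega)
          rw [Nat.add_sub_cancel' hj.1] at hJ
          refine ⟨J, hJ.1, hσ.sum_remaining_le_response hJ hr.le ?_ _⟩
          rw [hσ.work_eq_zero hJ (hr ▸ by simp), hτ, sub_zero]

end Schedule

/-! ### Offline schedules that run each job in one block -/

/-- The total processing time of the first `l` tasks of a job. -/
noncomputable def Job.offset (J : Job) (l : ℕ) : ℝ := ((J.tasks.take l).map Task.size).sum

theorem Job.offset_mono (J : Job) : Monotone J.offset := by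
  refine monotone_nat_of_le_succ fun l => ?_
  simp only [Job.offset, List.take_add_one, List.map_append, List.sum_append]
  cases h : J.tasks[l]? with
  | none => simp
  | some τ => simpa using τ.size_pos.le

theorem Job.offset_succ (J : Job) {l : ℕ} {τ : Task} (h : J.tasks[l]? = some τ) :
    J.offset (l + 1) = J.offset l + τ.size := by
  simp [Job.offset, List.take_add_one, h]

theorem Job.offset_nonneg (J : Job) (l : ℕ) : 0 ≤ J.offset l := by
  simpa [Job.offset] using J.offset_mono (Nat.zero_le l)

theorem Job.offset_add_size_le (J : Job) {l : ℕ} {τ : Task} (h : J.tasks[l]? = some τ) :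
    J.offset l + τ.size ≤ J.workload := by
  rw [← J.offset_succ h]
  have hl := (List.getElem?_eq_some_iff.1 h).1
  have := J.offset_mono (show l + 1 ≤ J.tasks.length from hl)
  simpa [Job.offset, Job.workload] using this

/-- A job together with a machine and a starting time: the job is to be run on this machine without
interruption, one task after the other. -/
structure PlacedJob (N : ℕ) where
  job : Job
  machine : Fin N
  start : ℝ

namespace PlacedJob

variable {N : ℕ}

/-- The time at which a placed job is finished. -/
noncomputable def finish (P : PlacedJob N) : ℝ := P.start + P.job.workload

/-- Two placed jobs do not conflict. -/
def Compatible (P Q : PlacedJob N) : Prop :=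
  P.machine = Q.machine → P.finish ≤ Q.start ∨ Q.finish ≤ P.start

theorem Compatible.symm {P Q : PlacedJob N} (h : P.Compatible Q) : Q.Compatible P :=
  fun hm => (h hm.symm).symm

/-- Task number `x.2` of job number `x.1` in the list is to be run at time `t` on machine `m`. -/
def Serves (L : List (PlacedJob N)) (t : ℝ) (m : Fin N) (x : ℕ × ℕ) : Prop :=
  ∃ P τ, L[x.1]? = some P ∧ P.job.tasks[x.2]? = some τ ∧ m = P.machine ∧
    t ∈ Ico (P.start + P.job.offset x.2) (P.start + P.job.offset x.2 + τ.size)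

open Classical in
/-- The schedule that runs the placed jobs as prescribed. -/
noncomputable def schedule (L : List (PlacedJob N)) : Schedule N := fun t m =>
  if h : ∃ x, Serves L t m x then some h.choose else none

theorem Serves.snd_eq {L : List (PlacedJob N)} {t : ℝ} {m m' : Fin N} {j l l' : ℕ}
    (h : Serves L t m (j, l)) (h' : Serves L t m' (j, l')) : l = l' ∧ m = m' := by
  obtain ⟨P, τ, hP, hτ, rfl, ht⟩ := h
  obtain ⟨P', τ', hP', hτ', rfl, ht'⟩ := h'
  dsimp only at *
  obtain rfl : P = P' := by simpa using hP.symm.trans hP'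
  refine ⟨?_, rfl⟩
  rw [add_assoc, ← P.job.offset_succ hτ] at ht
  rw [add_assoc, ← P.job.offset_succ hτ'] at ht'
  by_contra hne
  rcases Nat.lt_or_gt_of_ne hne with hlt | hlt
  · linarith [P.job.offset_mono (show l + 1 ≤ l' from hlt), ht.2, ht'.1]
  · linarith [P.job.offset_mono (show l' + 1 ≤ l from hlt), ht.1, ht'.2]

theorem Serves.unique {L : List (PlacedJob N)} (hL : L.Pairwise Compatible) {t : ℝ} {m : Fin N}
    {x y : ℕ × ℕ} (hx : Serves L t m x) (hy : Serves L t m y) : x = y := by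
  obtain ⟨j, l⟩ := x
  obtain ⟨j', l'⟩ := y
  have hjj : j = j' := by
    by_contra hne
    obtain ⟨P, τ, hP, hτ, hm, ht⟩ := hx
    obtain ⟨Q, τ', hQ, hτ', hm', ht'⟩ := hy
    have hcomp : P.Compatible Q := by
      dsimp only at *
      obtain ⟨hj, rfl⟩ := List.getElem?_eq_some_iff.1 hP
      obtain ⟨hj', rfl⟩ := List.getElem?_eq_some_iff.1 hQ
      rw [List.pairwise_iff_getElem] at hL
      rcases Nat.lt_or_gt_of_ne hne with hlt | hlt
      · exact hL _ _ hj hj' hlt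
      · exact (hL _ _ hj' hj hlt).symm
    have h1 := P.job.offset_add_size_le hτ
    have h2 := Q.job.offset_add_size_le hτ'
    have h3 := P.job.offset_nonneg l
    have h4 := Q.job.offset_nonneg l'
    obtain ⟨h5, h6⟩ := ht
    obtain ⟨h7, h8⟩ := ht'
    dsimp only [finish] at *
    rcases hcomp (hm.symm.trans hm') with h | h
    · simp only [finish] at h; linarith
    · simp only [finish] at h; linarith
  subst hjj
  rw [(Serves.snd_eq hx hy).1]

theorem schedule_eq_some_iff {L : List (PlacedJob N)} (hL : L.Pairwise Compatible) {t : ℝ}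
    {m : Fin N} {x : ℕ × ℕ} : schedule L t m = some x ↔ Serves L t m x := by
  unfold schedule
  split_ifs with h
  · rw [Option.some.injEq]
    exact ⟨fun hx => hx ▸ h.choose_spec, fun hx => h.choose_spec.unique hL hx⟩
  · simp only [false_iff]
    exact fun hx => h ⟨x, hx⟩

theorem serviceTimes_schedule {L : List (PlacedJob N)} (hL : L.Pairwise Compatible) {j l : ℕ}
    {P : PlacedJob N} {τ : Task} (hP : L[j]? = some P) (hτ : P.job.tasks[l]? = some τ) :
    (schedule L).serviceTimes j l =
      Ico (P.start + P.job.offset l) (P.start + P.job.offset l + τ.size) := by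
  ext t
  simp [Schedule.serviceTimes, schedule_eq_some_iff hL, Serves, hP, hτ]

theorem exists_of_isTask {L : List (PlacedJob N)} {ω : Instance}
    (hω : ω.jobs = L.map PlacedJob.job) {j l : ℕ} {J : Job} {τ : Task} (h : ω.IsTask j l J τ) :
    ∃ P, L[j]? = some P ∧ P.job = J ∧ P.job.tasks[l]? = some τ := by
  obtain ⟨h1, h2⟩ := h
  rw [hω, List.getElem?_map, Option.map_eq_some_iff] at h1
  obtain ⟨P, hP, rfl⟩ := h1
  exact ⟨P, hP, rfl, h2⟩

/-- The tasks of a job occupy consecutive intervals on one machine, so nothing is interrupted or run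
in parallel, and the schedule is feasible in either scenario. -/
theorem feasible_schedule (par : Prop) {L : List (PlacedJob N)} (hL : L.Pairwise Compatible)
    {ω : Instance} (hω : ω.jobs = L.map PlacedJob.job)
    (hrel : ∀ P ∈ L, P.job.release ≤ P.start) : (schedule L).Feasible par ω where
  measurable m j l := by
    simp only [schedule_eq_some_iff hL, Serves]
    cases hP : L[j]? with
    | none => simp
    | some P =>
      cases hτ : P.job.tasks[l]? with
      | none => simp [hτ]
      | some τ =>
        by_cases hm : m = P.machine
        · convert (measurableSet_Ico :
            MeasurableSet (Ico (P.start + P.job.offset l) (P.start + P.job.offset l + τ.size)))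
            using 1
          ext t
          simp [hm, hτ]
        · simp [hm]
  released t m j l h := by
    rw [schedule_eq_some_iff hL] at h
    obtain ⟨P, τ, hP, hτ, -, ht⟩ := h
    refine ⟨P.job, τ, ⟨by simp_all, hτ⟩, ?_⟩
    linarith [hrel P (List.mem_of_getElem? hP), ht.1, P.job.offset_nonneg l]
  no_split t m m' j l h h' := by
    rw [schedule_eq_some_iff hL] at h h'
    exact (h.snd_eq h').2
  no_parallel _ t m m' j l l' h h' := by
    rw [schedule_eq_some_iff hL] at h h'
    exact (h.snd_eq h').2
  total j l J τ h := by
    obtain ⟨P, hP, rfl, hτ⟩ := exists_of_isTask hω h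
    rw [serviceTimes_schedule hL hP hτ, Real.volume_Ico, add_sub_cancel_left]
  finishes j l J τ h := by
    obtain ⟨P, hP, rfl, hτ⟩ := exists_of_isTask hω h
    rw [serviceTimes_schedule hL hP hτ]
    exact ⟨_, fun t ht => ht.2⟩
  nonpreemptive j l J τ h _ := by
    obtain ⟨P, hP, rfl, hτ⟩ := exists_of_isTask hω h
    refine ⟨P.machine, P.start + P.job.offset l, fun t m' => ?_⟩
    rw [schedule_eq_some_iff hL]
    simp [Serves, hP, hτ]

theorem jobCompletion_schedule_le {L : List (PlacedJob N)} (hL : L.Pairwise Compatible)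
    {j : ℕ} {P : PlacedJob N} (hP : L[j]? = some P) :
    (schedule L).jobCompletion j P.job ≤ P.finish := by
  refine csSup_le ?_ ?_
  · obtain ⟨τ, τs, hτ⟩ := List.exists_cons_of_ne_nil P.job.tasks_ne_nil
    exact ⟨_, 0, τ, by simp [hτ], rfl⟩
  · rintro c ⟨l, τ, hτ, rfl⟩
    refine (csInf_le ?_ (a := P.start + P.job.offset l + τ.size) ?_).trans ?_
    -- `csInf_le` needs a lower bound: no work is done before the task's interval.
    · refine ⟨P.start + P.job.offset l, fun t ht => ?_⟩
      by_contra! hlt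
      have : (schedule L).serviceTimes j l ∩ Iic t = ∅ := by
        rw [serviceTimes_schedule hL hP hτ]
        ext u
        simp only [mem_inter_iff, mem_Ico, mem_Iic, mem_empty_iff_false, iff_false]
        rintro ⟨⟨h1, -⟩, h2⟩
        linarith
      simp only [mem_ofPred_eq, Schedule.work, this, measure_empty, ENNReal.toReal_zero] at ht
      exact absurd τ.size_pos ht.not_gt
    · have : (schedule L).serviceTimes j l ∩ Iic (P.start + P.job.offset l + τ.size) =
          (schedule L).serviceTimes j l := by
        rw [serviceTimes_schedule hL hP hτ]
        exact inter_eq_left.2 fun u hu => hu.2.le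
      rw [mem_ofPred_eq, Schedule.work, this, serviceTimes_schedule hL hP hτ, Real.volume_Ico,
        add_sub_cancel_left, ENNReal.toReal_ofReal τ.size_pos.le]
    · have := P.job.offset_add_size_le hτ
      simp only [finish]
      linarith

/-- The response time of a placed job. -/
noncomputable def response (P : PlacedJob N) : ℝ := P.finish - P.job.release

theorem opt_le (par : Prop) {L : List (PlacedJob N)} (hL : L.Pairwise Compatible)
    {ω : Instance} (hω : ω.jobs = L.map PlacedJob.job)
    (hrel : ∀ P ∈ L, P.job.release ≤ P.start) :
    opt N par ω ≤ (L.map response).sum := by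
  refine (opt_le_cost (feasible_schedule par hL hω hrel)).trans ?_
  obtain ⟨jobs, h1, h2⟩ := ω
  dsimp only at hω
  subst hω
  rw [Schedule.cost, ← List.sum_ofFn, List.ofFn_congr (List.length_map _)]
  conv_rhs => rw [← List.ofFn_get L, List.map_ofFn]
  rw [List.sum_ofFn, List.sum_ofFn]
  refine Finset.sum_le_sum fun j _ => ?_
  have := jobCompletion_schedule_le hL (j := j) (P := L.get j) (by simp)
  simpa [response] using this

end PlacedJob

/-! ### Building blocks: single jobs, big jobs, streams -/

/-- A job with a single task, which is preemptive. -/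
def Job.single (p r : ℝ) (hp : 0 < p) (hr : 0 ≤ r) : Job :=
  ⟨r, hr, [⟨p, hp, true⟩], by simp⟩

@[simp] theorem Job.single_release (p r : ℝ) (hp : 0 < p) (hr : 0 ≤ r) :
    (Job.single p r hp hr).release = r := rfl

@[simp] theorem Job.single_workload (p r : ℝ) (hp : 0 < p) (hr : 0 ≤ r) :
    (Job.single p r hp hr).workload = p := by simp [Job.single, Job.workload]

@[simp] theorem Job.single_tasks (p r : ℝ) (hp : 0 < p) (hr : 0 ≤ r) :
    (Job.single p r hp hr).tasks = [⟨p, hp, true⟩] := rfl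

/-- A job of workload `α` that consists of a non-preemptive task of length `β` and
a preemptive task (if these lengths are not zero). -/
noncomputable def Job.big (α β r : ℝ) (hα : 0 < α) (_hβ : β ≤ α) (hr : 0 ≤ r) : Job :=
  ⟨r, hr, (if h : 0 < β then [⟨β, h, false⟩] else []) ++
    (if h : max β 0 < α then [⟨α - max β 0, sub_pos.2 h, true⟩] else []), by
      split_ifs with h1 h2 h2
      · simp
      · simp
      · simp
      · exact absurd (max_lt_iff.2 ⟨(not_lt.1 h1).trans_lt hα, hα⟩) h2⟩

section big

variable {α β r : ℝ} (hα : 0 < α) (hβ : β ≤ α) (hr : 0 ≤ r)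

@[simp] theorem Job.big_release : (Job.big α β r hα hβ hr).release = r := rfl

@[simp] theorem Job.big_workload : (Job.big α β r hα hβ hr).workload = α := by
  unfold Job.big Job.workload
  split_ifs with h1 h2 h2
  · simp [max_eq_left h1.le]
  · rw [max_eq_left h1.le] at h2
    simpa using le_antisymm hβ (not_lt.1 h2)
  · simp [max_eq_right (not_lt.1 h1)]
  · exact absurd (max_lt_iff.2 ⟨(not_lt.1 h1).trans_lt hα, hα⟩) h2

theorem Job.big_nonpreemptive {τ : Task} (h : τ ∈ (Job.big α β r hα hβ hr).tasks)
    (hτ : τ.preemptive = false) : τ.size = β := by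
  unfold Job.big at h
  split_ifs at h <;> simp at h <;> aesop

theorem Job.big_getElem?_zero (h : 0 < β) :
    (Job.big α β r hα hβ hr).tasks[0]? = some ⟨β, h, false⟩ := by
  simp [Job.big, h]

end big

/-- Successive groups of `N` jobs with one unit of work, released at the times
`r, r + 1, …, r + K - 1`. -/
def rounds (N : ℕ) (r : ℝ) (hr : 0 ≤ r) (K : ℕ) : List Job :=
  (List.range (N * K)).map fun q =>
    Job.single 1 (r + (q / N : ℕ)) one_pos (add_nonneg hr (Nat.cast_nonneg _))

section rounds

variable {N : ℕ} {r : ℝ} {hr : 0 ≤ r} {K : ℕ}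

theorem mem_rounds {J : Job} : J ∈ rounds N r hr K ↔
    ∃ q < N * K, Job.single 1 (r + (q / N : ℕ)) one_pos (add_nonneg hr (Nat.cast_nonneg _)) = J := by
  simp [rounds]

/-- For causality: prolonging a stream is invisible until its original end. -/
theorem rounds_add (N : ℕ) (r : ℝ) (hr : 0 ≤ r) (K K' : ℕ) :
    ∃ L, rounds N r hr (K + K') = rounds N r hr K ++ L ∧ ∀ J ∈ L, r + K ≤ J.release := by
  refine ⟨_, by rw [rounds, mul_add, List.range_add, List.map_append]; rfl, ?_⟩
  simp only [List.map_map, List.mem_map, List.mem_range, Function.comp_apply]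
  rintro _ ⟨q, hq, rfl⟩
  have hN : 0 < N := by
    rcases Nat.eq_zero_or_pos N with rfl | h
    · simp at hq
    · exact h
  have : K ≤ (N * K + q) / N := (Nat.le_div_iff_mul_le hN).2 (by rw [mul_comm]; omega)
  have : (K : ℝ) ≤ ((N * K + q) / N : ℕ) := by exact_mod_cast this
  simpa using this

theorem le_release_of_mem_rounds {J : Job} (h : J ∈ rounds N r hr K) : r ≤ J.release := by
  obtain ⟨q, -, rfl⟩ := mem_rounds.1 h
  simp

theorem release_le_of_mem_rounds {J : Job} (h : J ∈ rounds N r hr K) : J.release ≤ r + K := by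
  obtain ⟨q, hq, rfl⟩ := mem_rounds.1 h
  have : (q / N : ℕ) ≤ K := Nat.div_le_of_le_mul hq.le
  simpa using this

theorem pairwise_rounds : (rounds N r hr K).Pairwise fun J J' => J.release ≤ J'.release := by
  rw [rounds, List.pairwise_map]
  refine List.pairwise_lt_range.imp fun {a b} hab => ?_
  simpa using Nat.div_le_div_right hab.le

theorem isTask_of_jobs_eq {ω : Instance} {L L' : List Job}
    (hω : ω.jobs = L ++ (rounds N r hr K ++ L')) {q : ℕ} (hq : q < N * K) :
    ∃ J τ, ω.IsTask (L.length + q) 0 J τ ∧ τ.size = 1 ∧ J.release = r + (q / N : ℕ) := by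
  refine ⟨_, ⟨1, one_pos, true⟩, ⟨?_, ?_⟩, rfl, Job.single_release 1 _ one_pos
    (add_nonneg hr (Nat.cast_nonneg _))⟩
  · rw [hω, List.getElem?_append_right (by omega), Nat.add_sub_cancel_left,
      List.getElem?_append_left (by simpa [rounds] using hq)]
    simp [rounds, hq]
  · simp

/-- The rounds, with each job run as soon as it is released. -/
def roundsPlaced (N : ℕ) (hN : 0 < N) (r : ℝ) (hr : 0 ≤ r) (K : ℕ) : List (PlacedJob N) :=
  (List.range (N * K)).map fun q =>
    ⟨Job.single 1 (r + (q / N : ℕ)) one_pos (add_nonneg hr (Nat.cast_nonneg _)),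
      ⟨q % N, Nat.mod_lt _ hN⟩, r + (q / N : ℕ)⟩

variable {hN : 0 < N}

theorem map_roundsPlaced : (roundsPlaced N hN r hr K).map PlacedJob.job = rounds N r hr K := by
  simp [roundsPlaced, rounds]

theorem mem_roundsPlaced {P : PlacedJob N} (h : P ∈ roundsPlaced N hN r hr K) :
    P.job.release = P.start ∧ r ≤ P.start ∧ P.finish ≤ r + K := by
  simp only [roundsPlaced, List.mem_map, List.mem_range] at h
  obtain ⟨q, hq, rfl⟩ := h
  refine ⟨rfl, by simp, ?_⟩
  have h1 : q / N < K := (Nat.div_lt_iff_lt_mul hN).2 (by rwa [mul_comm])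
  have h2 : ((q / N : ℕ) : ℝ) + 1 ≤ K := by exact_mod_cast h1
  simp only [PlacedJob.finish, Job.single_workload]
  linarith

theorem compatible_of_lt {x y : ℕ} {P Q : PlacedJob N} (hxy : x < y) (s : ℝ)
    (hP : P.start = s + x) (hQ : Q.start = s + y) (hP1 : P.job.workload = 1) : P.Compatible Q := by
  have h2 : (x : ℝ) + 1 ≤ y := by exact_mod_cast hxy
  intro _
  left
  rw [PlacedJob.finish, hP, hP1, hQ]
  linarith

theorem div_lt_div_of_mod_eq {a b : ℕ} (hab : a < b) (h : a % N = b % N) : a / N < b / N := by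
  refine lt_of_le_of_ne (Nat.div_le_div_right hab.le) fun h' => hab.ne ?_
  rw [← Nat.div_add_mod a N, ← Nat.div_add_mod b N, h, h']

theorem pairwise_roundsPlaced : (roundsPlaced N hN r hr K).Pairwise PlacedJob.Compatible := by
  rw [roundsPlaced, List.pairwise_map]
  refine List.pairwise_lt_range.imp fun {a b} hab hm => ?_
  exact compatible_of_lt (div_lt_div_of_mod_eq hab (by simpa using hm)) r rfl rfl (by simp) hm

theorem sum_response_roundsPlaced :
    ((roundsPlaced N hN r hr K).map PlacedJob.response).sum = N * K := by
  simp [roundsPlaced, PlacedJob.response, PlacedJob.finish, Function.comp_def]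

end rounds

/-! ### Parameters of an instance and information revealed -/

theorem alpha_eq {ω : Instance} {α : ℝ} (h1 : ∀ J ∈ ω.jobs, 1 ≤ J.workload ∧ J.workload ≤ α)
    (h2 : ∃ J ∈ ω.jobs, J.workload = 1) (h3 : ∃ J ∈ ω.jobs, J.workload = α) :
    ω.minWorkload = 1 ∧ ω.alpha = α := by
  have hmin : ω.minWorkload = 1 := by
    obtain ⟨J, hJ, hJ1⟩ := h2
    refine IsLeast.csInf_eq ⟨⟨J, hJ, hJ1.symm⟩, ?_⟩
    rintro _ ⟨J, hJ, rfl⟩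
    exact (h1 J hJ).1
  have hmax : ω.maxWorkload = α := by
    obtain ⟨J, hJ, hJ1⟩ := h3
    refine IsGreatest.csSup_eq ⟨⟨J, hJ, hJ1.symm⟩, ?_⟩
    rintro _ ⟨J, hJ, rfl⟩
    exact (h1 J hJ).2
  exact ⟨hmin, by rw [Instance.alpha, hmin, hmax, div_one]⟩

theorem beta_eq {ω : Instance} {β : ℝ} (hmin : ω.minWorkload = 1) (hβ : 0 ≤ β)
    (h1 : ∀ J ∈ ω.jobs, ∀ τ ∈ J.tasks, τ.preemptive = false → τ.size = β)
    (h2 : 0 < β → ∃ J ∈ ω.jobs, ∃ τ ∈ J.tasks, τ.preemptive = false ∧ τ.size = β) :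
    ω.beta = β := by
  rw [Instance.beta, hmin, div_one, Instance.eta]
  rcases hβ.eq_or_lt with rfl | hβ
  · convert Real.sSup_empty
    rw [Set.eq_empty_iff_forall_notMem]
    rintro _ ⟨J, hJ, τ, hτ, hp, rfl⟩
    exact τ.size_pos.ne' (h1 J hJ τ hτ hp)
  · obtain ⟨J, hJ, τ, hτ, hp, hs⟩ := h2 hβ
    refine IsGreatest.csSup_eq ⟨⟨J, hJ, τ, hτ, hp, hs.symm⟩, ?_⟩
    rintro _ ⟨J, hJ, τ, hτ, hp, rfl⟩
    exact (h1 J hJ τ hτ hp).le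

/-- An instance has the parameters `α` and `β` if it contains a unit job and a big job with these
parameters, and all other jobs are single preemptive tasks of size between `1` and `α`. -/
theorem alpha_eq_and_beta_eq {ω : Instance} {α β r₀ : ℝ} (hα : 1 ≤ α) (hβ0 : 0 ≤ β) (hβ : β ≤ α)
    (hr₀ : 0 ≤ r₀) (hunit : ∃ r hr, Job.single 1 r one_pos hr ∈ ω.jobs)
    (hbig : Job.big α β r₀ (one_pos.trans_le hα) hβ hr₀ ∈ ω.jobs)
    (hall : ∀ J ∈ ω.jobs, J = Job.big α β r₀ (one_pos.trans_le hα) hβ hr₀ ∨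
      ∃ p r hp hr, J = Job.single p r hp hr ∧ 1 ≤ p ∧ p ≤ α) :
    ω.alpha = α ∧ ω.beta = β := by
  obtain ⟨r, hr, hunit⟩ := hunit
  obtain ⟨hmin, halpha⟩ := alpha_eq (ω := ω) (α := α) (by
    intro J hJ
    rcases hall J hJ with rfl | ⟨p, r, hp, hr, rfl, h1, h2⟩
    · simpa using hα
    · simpa using ⟨h1, h2⟩) ⟨_, hunit, by simp⟩ ⟨_, hbig, by simp⟩
  refine ⟨halpha, beta_eq hmin hβ0 ?_ fun h => ⟨_, hbig, _,
    List.mem_of_getElem? (Job.big_getElem?_zero _ _ _ h), rfl, rfl⟩⟩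
  intro J hJ τ hτ hp
  rcases hall J hJ with rfl | ⟨p, r, hp, hr, rfl, h1, h2⟩
  · exact Job.big_nonpreemptive _ _ _ hτ hp
  · simp only [Job.single_tasks, List.mem_singleton] at hτ
    subst hτ
    simp at hp

/-- This makes causality applicable: two continuations of a common input are indistinguishable until
one of them releases a job. -/
theorem revealed_append {ω ω' : Instance} {L L₁ L₂ : List Job} {t : ℝ} (h : ω.jobs = L ++ L₁)
    (h' : ω'.jobs = L ++ L₂) (h₁ : ∀ J ∈ L₁, t < J.release) (h₂ : ∀ J ∈ L₂, t < J.release) :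
    ω.revealed t = ω'.revealed t := by
  have aux : ∀ M : List Job, (∀ J ∈ M, t < J.release) →
      M.filter (fun J => decide (J.release ≤ t)) = [] := by
    intro M hM
    simpa using hM
  rw [Instance.revealed, Instance.revealed, h, h', List.filter_append, List.filter_append]
  congr 1
  convert (aux _ h₁).trans (aux _ h₂).symm

/-! ### The lower bound in `β` -/

namespace OnlineAlgorithm

variable {N : ℕ} {par : Prop}

/-- Covers small parameters, where the claimed bounds are at most `1`; it is enough to exhibit one
instance with these parameters. -/
theorem one_le_competitiveRatio_of_le (A : OnlineAlgorithm N par) {α β : ℝ} (hα : 1 ≤ α)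
    (hβ0 : 0 ≤ β) (hβ : β ≤ α) : ENNReal.ofReal 1 ≤ A.competitiveRatio α β := by
  let ω : Instance := ⟨[Job.single 1 0 one_pos le_rfl,
    Job.big α β 0 (one_pos.trans_le hα) hβ le_rfl], by simp, by simp⟩
  obtain ⟨h1, h2⟩ := alpha_eq_and_beta_eq (ω := ω) hα hβ0 hβ le_rfl
    ⟨0, le_rfl, by simp [ω]⟩ (by simp [ω]) (by
      intro J hJ
      simp only [ω, List.mem_cons, List.not_mem_nil, or_false] at hJ
      rcases hJ with rfl | rfl
      · exact Or.inr ⟨_, _, _, _, rfl, le_rfl, hα⟩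
      · exact Or.inl rfl)
  exact A.one_le_competitiveRatio h1 h2

/-- Once a long non-preemptive task has been started, a machine is blocked for unit jobs. -/
theorem mul_beta_le_competitiveRatio_of_four_le (hN : 0 < N) (A : OnlineAlgorithm N par)
    {α β : ℝ} (hα : 1 ≤ α) (hβ4 : 4 ≤ β) (hβ : β ≤ α) :
    ENNReal.ofReal (β / (4 * (N + 3))) ≤ A.competitiveRatio α β := by
  have hα0 : 0 < α := one_pos.trans_le hα
  have hβ0 : 0 < β := by linarith
  set big : Job := Job.big α β 0 hα0 hβ le_rfl with hbig
  have htask : big.tasks[0]? = some ⟨β, hβ0, false⟩ := Job.big_getElem?_zero _ _ _ hβ0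
  -- A probe: the starting time chosen on the lone big job determines when the stream is released.
  let ω₀ : Instance := ⟨[big], by simp, by simp⟩
  obtain ⟨m, s, hs⟩ := (A.feasible ω₀).nonpreemptive 0 0 big ⟨β, hβ0, false⟩ ⟨rfl, htask⟩ rfl
  dsimp only at hs
  have hsm : A.schedule ω₀ s m = some (0, 0) :=
    (hs s m).2 ⟨rfl, le_rfl, by linarith⟩
  have hs0 : 0 ≤ s := by
    obtain ⟨J, τ, -, hJ⟩ := (A.feasible ω₀).released s m 0 0 hsm
    exact J.release_nonneg.trans hJ
  have hr : 0 ≤ s + 1 := by linarith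
  set K := ⌈2 * α⌉₊ with hK
  have hKα : 2 * α ≤ K := Nat.le_ceil _
  let ω : Instance := ⟨big :: rounds N (s + 1) hr K, by simp, by
    rw [List.pairwise_cons]
    exact ⟨fun J _ => J.release_nonneg, pairwise_rounds⟩⟩
  have hK0 : 0 < N * K := Nat.mul_pos hN (Nat.ceil_pos.2 (by linarith))
  obtain ⟨h1, h2⟩ := alpha_eq_and_beta_eq (ω := ω) hα hβ0.le hβ le_rfl
    ⟨_, _, List.mem_cons_of_mem _ (mem_rounds.2 ⟨0, hK0, rfl⟩)⟩ (List.mem_cons_self) (by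
      intro J hJ
      rcases List.mem_cons.1 hJ with rfl | hJ
      · exact Or.inl rfl
      · obtain ⟨q, -, rfl⟩ := mem_rounds.1 hJ
        exact Or.inr ⟨_, _, _, _, rfl, le_rfl, hα⟩)
  -- the optimum runs the big job either before or after the unit jobs
  obtain ⟨T, hT0, hT1, hT2⟩ : ∃ T : ℝ, 0 ≤ T ∧ (T + α ≤ s + 1 ∨ s + 1 + K ≤ T) ∧
      T ≤ α + 1 + K := by
    rcases le_total α s with h | h
    · exact ⟨0, le_rfl, Or.inl (by linarith), by positivity⟩
    · exact ⟨s + 1 + K, by positivity, Or.inr le_rfl, by linarith⟩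
  have hopt := PlacedJob.opt_le (N := N) par (ω := ω)
    (L := ⟨big, ⟨0, hN⟩, T⟩ :: roundsPlaced N hN (s + 1) hr K) (by
      rw [List.pairwise_cons]
      refine ⟨fun P hP _ => ?_, pairwise_roundsPlaced⟩
      obtain ⟨-, h3, h4⟩ := mem_roundsPlaced hP
      simp only [PlacedJob.finish, hbig, Job.big_workload] at h4 ⊢
      rcases hT1 with h | h
      · left; linarith
      · right; linarith) (by simp [ω, map_roundsPlaced]) (by
      intro P hP
      rcases List.mem_cons.1 hP with rfl | hP
      · exact hT0
      · exact (mem_roundsPlaced hP).1.le)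
  rw [List.map_cons, List.sum_cons, sum_response_roundsPlaced] at hopt
  simp only [PlacedJob.response, PlacedJob.finish, hbig, Job.big_workload, Job.big_release]
    at hopt
  -- the algorithm starts the non-preemptive task at time `s`
  have hagree : ∀ t < s + 1, A.schedule ω₀ t = A.schedule ω t := fun t ht =>
    A.causal ω₀ ω t (revealed_append (L := [big]) (L₁ := []) (L₂ := rounds N (s + 1) hr K)
      rfl rfl (by simp) fun J hJ => ht.trans_le (le_release_of_mem_rounds hJ))
  obtain ⟨m', s', hs'⟩ := (A.feasible ω).nonpreemptive 0 0 big ⟨β, hβ0, false⟩ ⟨rfl, htask⟩ rfl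
  dsimp only at hs'
  -- The two schedules agree before `s + 1`, hence at `s`, where the task is already running; so its
  -- start is the same in both.
  have hss : s' = s := by
    have h3 := (hs' s m).1 (by rw [← hagree s (by linarith)]; exact hsm)
    have h4 := (hs' s' m').2 ⟨rfl, le_rfl, by linarith⟩
    rw [← hagree s' (by linarith [h3.2.1])] at h4
    exact le_antisymm h3.2.1 ((hs s' m').1 h4).2.1
  subst hss
  -- One unit of the task may be done before the stream starts; the rest blocks a machine for the
  -- next `a` rounds.
  set a := ⌊β - 1⌋₊ with ha
  have ha1 : (a : ℝ) ≤ β - 1 := Nat.floor_le (by linarith)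
  have ha2 : β - 1 < a + 1 := Nat.lt_floor_add_one _
  have haK : a ≤ K := by
    have : (a : ℝ) ≤ K := by linarith
    exact_mod_cast this
  have hwork : (a : ℝ) ≤ (A.schedule ω).work 0 0 (s' + 1 + a) -
      (A.schedule ω).work 0 0 (s' + 1) := by
    rw [(A.feasible ω).work_sub_work 0 0 (by simp)]
    calc (a : ℝ) = volume.real (Ioo (s' + 1) (s' + 1 + a)) := by simp
      _ ≤ _ := by
        refine measureReal_mono ?_ (measure_ne_top_of_subset inter_subset_right (by simp))
        intro t ht
        exact ⟨⟨m', (hs' t m').2 ⟨rfl, by linarith [ht.1], by linarith [ht.2]⟩⟩, ht.1, ht.2.le⟩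
  have hcost := (A.feasible ω).mul_le_cost_of_rounds hN (n := 1) (r := s' + 1) (V := a) haK
    (fun q hq => isTask_of_jobs_eq (hr := hr) (L := [big]) (L' := []) (by simp [ω]) hq)
    ∅ (by simp) (j₀ := 0) one_pos (by simp) (by simpa using hwork)
  refine A.le_competitiveRatio h1 h2 (y := (N + 3) * K) hcost (hopt.trans ?_) ?_ (by positivity)
  · linarith
  · have hN' : (0 : ℝ) < N + 3 := by positivity
    -- Here `a ≥ β / 2` since `β ≥ 4`, and `K - a ≥ K / 2` since `K ≥ 2 * α ≥ 2 * β`.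
    have : β / (4 * (N + 3)) * ((N + 3) * K) = (K / 2) * (β / 2) := by field_simp; ring
    rw [this]
    exact mul_le_mul (by linarith) (by linarith) (by linarith) (by linarith)

theorem mul_beta_le_competitiveRatio (hN : 0 < N) (A : OnlineAlgorithm N par)
    {α β : ℝ} (hα : 1 ≤ α) (hβ0 : 0 ≤ β) (hβ : β ≤ α) :
    ENNReal.ofReal (1 / (4 * (N + 3)) * β) ≤ A.competitiveRatio α β := by
  rcases le_total 4 β with h | h
  · convert A.mul_beta_le_competitiveRatio_of_four_le hN hα h hβ using 2
    ring
  · refine le_trans (ENNReal.ofReal_le_ofReal ?_) (A.one_le_competitiveRatio_of_le hα hβ0 hβ)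
    rw [one_div, inv_mul_le_iff₀ (by positivity)]
    have : (0 : ℝ) ≤ N := by positivity
    linarith

theorem not_isLittleOCompetitive (hN : 0 < N) (A : OnlineAlgorithm N par) :
    ¬ A.IsLittleOCompetitive := by
  intro h
  set c : ℝ := 1 / (4 * (N + 3)) with hc
  have hc0 : 0 < c := by positivity
  obtain ⟨M, hM⟩ := h (c / 4) (by positivity)
  -- On the diagonal `β = α` the logarithm is dominated by `β`, so the linear bound already
  -- contradicts `ε = c / 4`.
  set α := max M 1 with hα
  have h1 : 1 ≤ α := le_max_right _ _
  have hlog : Real.log α ≤ α := (Real.log_le_sub_one_of_pos (by linarith)).trans (by linarith)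
  have hlog0 : 0 ≤ Real.log α := Real.log_nonneg h1
  have h2 := hM α α h1 (by linarith) le_rfl (by linarith [le_max_left M 1])
  have h3 := (A.mul_beta_le_competitiveRatio hN h1 (by linarith) le_rfl).trans h2
  rw [ENNReal.ofReal_le_ofReal_iff (by positivity)] at h3
  nlinarith

end OnlineAlgorithm

/-! ### Phases of geometrically decreasing length -/

/-- Half of the length of a phase. -/
def halfPhase (M i : ℕ) : ℕ := 4 ^ (M - i)

theorem halfPhase_pos (M i : ℕ) : 0 < halfPhase M i := by unfold halfPhase; positivity

theorem halfPhase_succ {M i : ℕ} (h : i < M) : halfPhase M i = 4 * halfPhase M (i + 1) := by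
  rw [halfPhase, halfPhase, ← pow_succ']
  congr 1
  omega

theorem halfPhase_antitone (M : ℕ) : Antitone (halfPhase M) := fun _ _ hij =>
  Nat.pow_le_pow_right (by norm_num) (Nat.sub_le_sub_left hij M)

/-- The starting time of a phase. -/
noncomputable def phaseStart (M i : ℕ) : ℝ := 8 / 3 * ((halfPhase M 0 : ℝ) - halfPhase M i)

theorem phaseStart_mono (M : ℕ) : Monotone (phaseStart M) := by
  intro i j hij
  have : (halfPhase M j : ℝ) ≤ halfPhase M i := by exact_mod_cast halfPhase_antitone M hij
  unfold phaseStart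
  linarith

theorem phaseStart_nonneg (M i : ℕ) : 0 ≤ phaseStart M i := by
  simpa [phaseStart] using phaseStart_mono M (Nat.zero_le i)

/-- The factor `8 / 3` comes from summing the phase lengths `2 * halfPhase M i`, a geometric series
of ratio `1 / 4`. -/
theorem phaseStart_succ {M i : ℕ} (h : i < M) :
    phaseStart M (i + 1) = phaseStart M i + 2 * halfPhase M i := by
  rw [phaseStart, phaseStart, halfPhase_succ h]
  push_cast
  ring

/-- The long job of a phase. -/
noncomputable def longJob (M i : ℕ) : Job :=
  Job.single (2 * halfPhase M i) (phaseStart M i)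
    (by have := halfPhase_pos M i; positivity) (phaseStart_nonneg M i)

/-- The jobs of the first phases: in each phase one long job, and `N` unit jobs per unit of time
during the first half of the phase. -/
noncomputable def phases (N M : ℕ) : ℕ → List Job
  | 0 => []
  | i + 1 => phases N M i ++
      longJob M i :: rounds N (phaseStart M i) (phaseStart_nonneg M i) (halfPhase M i)

theorem phases_succ (N M i : ℕ) : phases N M (i + 1) = phases N M i ++
    longJob M i :: rounds N (phaseStart M i) (phaseStart_nonneg M i) (halfPhase M i) := rfl

theorem exists_phases_eq_append (N M : ℕ) {i j : ℕ} (hij : i ≤ j) :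
    ∃ L, phases N M j = phases N M i ++ L ∧ ∀ J ∈ L, phaseStart M i ≤ J.release := by
  induction j, hij using Nat.le_induction with
  | base => exact ⟨[], by simp, by simp⟩
  | succ j hij ih =>
    obtain ⟨L, hL, hrel⟩ := ih
    refine ⟨_, by rw [phases_succ, hL, List.append_assoc], fun J hJ => ?_⟩
    have hm := phaseStart_mono M hij
    rcases List.mem_append.1 hJ with h | h
    · exact hrel J h
    · rcases List.mem_cons.1 h with rfl | h
      · exact hm
      · exact hm.trans (le_release_of_mem_rounds h)

theorem getElem?_length_phases (N M : ℕ) {i j : ℕ} (hij : i < j) :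
    (phases N M j)[(phases N M i).length]? = some (longJob M i) := by
  obtain ⟨L, hL, -⟩ := exists_phases_eq_append N M (show i + 1 ≤ j from hij)
  rw [hL, phases_succ, List.append_assoc, List.getElem?_append_right le_rfl]
  simp

theorem length_phases_strictMono (N M : ℕ) : StrictMono fun i => (phases N M i).length := by
  refine strictMono_nat_of_lt_succ fun i => ?_
  simp only [phases_succ, List.length_append, List.length_cons]
  omega

theorem eq_single_of_mem_phases {N M i : ℕ} {J : Job} (h : J ∈ phases N M i) :
    ∃ p r hp hr, J = Job.single p r hp hr ∧ 1 ≤ p ∧ p ≤ 2 * 4 ^ M := by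
  have h4 : (1 : ℝ) ≤ 4 ^ M := one_le_pow₀ (by norm_num)
  induction i with
  | zero => simp [phases] at h
  | succ i ih =>
    rcases List.mem_append.1 h with h | h
    · exact ih h
    · rcases List.mem_cons.1 h with rfl | h
      · refine ⟨_, _, _, _, rfl, ?_, ?_⟩
        · have : (1 : ℝ) ≤ halfPhase M i := by exact_mod_cast halfPhase_pos M i
          linarith
        · have : halfPhase M i ≤ 4 ^ M := halfPhase_antitone M (Nat.zero_le i)
          have : (halfPhase M i : ℝ) ≤ 4 ^ M := by exact_mod_cast this
          linarith
      · obtain ⟨q, -, rfl⟩ := mem_rounds.1 h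
        exact ⟨_, _, _, _, rfl, le_rfl, by linarith⟩

/-- The unit jobs of a phase, placed so that the machine `0` remains free for the long job. -/
noncomputable def deferredRounds (N : ℕ) (hN : 2 ≤ N) (r : ℝ) (hr : 0 ≤ r) (h : ℕ) :
    List (PlacedJob N) :=
  (List.range (N * h)).map fun q =>
    ⟨Job.single 1 (r + (q / N : ℕ)) one_pos (add_nonneg hr (Nat.cast_nonneg _)),
      if q % N = 0 then ⟨1, hN⟩ else ⟨q % N, Nat.mod_lt _ (by omega)⟩,
      r + ((if q % N = 0 then h else 0) + q / N : ℕ)⟩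

section deferredRounds

variable {N : ℕ} {hN : 2 ≤ N} {r : ℝ} {hr : 0 ≤ r} {h : ℕ}

theorem map_deferredRounds :
    (deferredRounds N hN r hr h).map PlacedJob.job = rounds N r hr h := by
  simp [deferredRounds, rounds]

theorem mem_deferredRounds {P : PlacedJob N} (hP : P ∈ deferredRounds N hN r hr h) :
    P.job.release ≤ P.start ∧ r ≤ P.start ∧ P.finish ≤ r + 2 * h ∧ P.machine ≠ ⟨0, by omega⟩ := by
  simp only [deferredRounds, List.mem_map, List.mem_range] at hP
  obtain ⟨q, hq, rfl⟩ := hP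
  have h1 : q / N < h := (Nat.div_lt_iff_lt_mul (by omega)).2 (by rwa [mul_comm])
  have h2 : ((q / N : ℕ) : ℝ) + 1 ≤ h := by exact_mod_cast h1
  have h3 : (0 : ℝ) ≤ ((q / N : ℕ) : ℝ) := Nat.cast_nonneg _
  have h4 : (0 : ℝ) ≤ h := Nat.cast_nonneg _
  simp only [PlacedJob.finish, Job.single_workload, Job.single_release, Nat.cast_add]
  split_ifs with h0
  · exact ⟨by linarith, by linarith, by linarith, by simp⟩
  · simp only [Nat.cast_zero]
    exact ⟨by linarith, by linarith, by linarith, by simpa using h0⟩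

/-- Only machine `1` has extra work: its own unit jobs fill the first half of the phase, and those
diverted from machine `0` fill the second half. -/
theorem pairwise_deferredRounds :
    (deferredRounds N hN r hr h).Pairwise PlacedJob.Compatible := by
  rw [deferredRounds, List.pairwise_map]
  refine (List.Pairwise.and_mem.1 List.pairwise_lt_range).imp fun {a b} ⟨ha, hb, hab⟩ hm => ?_
  have ha' : a / N < h :=
    (Nat.div_lt_iff_lt_mul (by omega)).2 (by rw [mul_comm]; exact List.mem_range.1 ha)
  have hb' : b / N < h :=
    (Nat.div_lt_iff_lt_mul (by omega)).2 (by rw [mul_comm]; exact List.mem_range.1 hb)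
  have hm' := hm
  simp only at hm'
  have hdiv : a % N = b % N → a / N < b / N := div_lt_div_of_mod_eq hab
  have hcases : ((if a % N = 0 then h else 0) + a / N < (if b % N = 0 then h else 0) + b / N) ∨
      ((if b % N = 0 then h else 0) + b / N < (if a % N = 0 then h else 0) + a / N) := by
    clear hm
    generalize a / N = x at ha' hdiv ⊢
    generalize b / N = y at hb' hdiv ⊢
    split_ifs at hm' ⊢ with h1 h2 h2
    · have := hdiv (h1.trans h2.symm)
      omega
    · omega
    · omega
    · have := hdiv (by simpa using hm')
      omega
  rcases hcases with hlt | hlt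
  · exact compatible_of_lt hlt r rfl rfl (by simp) hm
  · exact (compatible_of_lt hlt r rfl rfl (by simp) hm.symm).symm

end deferredRounds

/-- No backlog crosses a phase boundary offline. The response times need no estimate, since a long
final stream will absorb them. -/
theorem exists_placement_phases {N M : ℕ} (hN : 2 ≤ N) {i : ℕ} (hi : i ≤ M) :
    ∃ L : List (PlacedJob N), L.map PlacedJob.job = phases N M i ∧
      L.Pairwise PlacedJob.Compatible ∧
      ∀ P ∈ L, P.job.release ≤ P.start ∧ P.finish ≤ phaseStart M i := by
  induction i with
  | zero => exact ⟨[], by simp [phases], by simp, by simp⟩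
  | succ i ih =>
    obtain ⟨L, hL, hcomp, hfin⟩ := ih (by omega)
    have hstart := phaseStart_succ (show i < M by omega)
    have hh : (0 : ℝ) < halfPhase M i := by exact_mod_cast halfPhase_pos M i
    refine ⟨L ++ ⟨longJob M i, ⟨0, by omega⟩, phaseStart M i⟩ ::
      deferredRounds N hN (phaseStart M i) (phaseStart_nonneg M i) (halfPhase M i), ?_, ?_, ?_⟩
    · rw [List.map_append, List.map_cons, map_deferredRounds, hL, phases_succ]
    · rw [List.pairwise_append, List.pairwise_cons]
      refine ⟨hcomp, ⟨fun P hP hm => ?_, pairwise_deferredRounds⟩, fun P hP Q hQ _ => Or.inl ?_⟩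
      · exact absurd hm.symm (mem_deferredRounds hP).2.2.2
      · refine (hfin P hP).2.trans ?_
        rcases List.mem_cons.1 hQ with rfl | hQ
        · exact le_rfl
        · exact (mem_deferredRounds hQ).2.1
    · intro P hP
      rcases List.mem_append.1 hP with hP | hP
      · have := hfin P hP
        exact ⟨this.1, by linarith⟩
      · rcases List.mem_cons.1 hP with rfl | hP
        · refine ⟨le_rfl, ?_⟩
          simp only [PlacedJob.finish, longJob, Job.single_workload]
          linarith
        · have := mem_deferredRounds hP
          exact ⟨this.1, by linarith⟩

theorem pairwise_phases {N M i : ℕ} (hi : i ≤ M) :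
    (phases N M i).Pairwise (fun J J' => J.release ≤ J'.release) ∧
      ∀ J ∈ phases N M i, J.release ≤ phaseStart M i := by
  induction i with
  | zero => simp [phases]
  | succ i ih =>
    obtain ⟨h1, h2⟩ := ih (by omega)
    have hstart := phaseStart_succ (show i < M by omega)
    have hh : (0 : ℝ) < halfPhase M i := by exact_mod_cast halfPhase_pos M i
    rw [phases_succ, List.pairwise_append, List.pairwise_cons]
    refine ⟨⟨h1, ⟨fun J hJ => le_release_of_mem_rounds hJ, pairwise_rounds⟩,
      fun J hJ J' hJ' => (h2 J hJ).trans ?_⟩, fun J hJ => ?_⟩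
    · rcases List.mem_cons.1 hJ' with rfl | hJ'
      · exact le_rfl
      · exact le_release_of_mem_rounds hJ'
    · rcases List.mem_append.1 hJ with hJ | hJ
      · have := h2 J hJ
        linarith
      · rcases List.mem_cons.1 hJ with rfl | hJ
        · simp only [longJob, Job.single_release]
          linarith
        · have := release_le_of_mem_rounds hJ
          linarith

/-- The instance consisting of `i` complete phases, a phase whose first half is prolonged very much,
and a big job long after all other jobs. -/
theorem exists_hard_instance {N M : ℕ} (hN : 2 ≤ N) (par : Prop) {α β : ℝ} (hα : 1 ≤ α)
    (hβ0 : 0 ≤ β) (hβ : β ≤ α) (hM : 2 * 4 ^ M ≤ α) {i : ℕ} (hi : i ≤ M) :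
    ∃ (K : ℕ) (ω : Instance) (big : Job),
      ω.jobs = (phases N M i ++ [longJob M i]) ++
        (rounds N (phaseStart M i) (phaseStart_nonneg M i) (halfPhase M i + K) ++ [big]) ∧
      phaseStart M i + halfPhase M i ≤ big.release ∧
      ω.alpha = α ∧ ω.beta = β ∧ opt N par ω ≤ (N + 2) * K := by
  have hα0 : 0 < α := one_pos.trans_le hα
  obtain ⟨L, hL, hcomp, hfin⟩ := exists_placement_phases (M := M) hN hi
  set r := phaseStart M i with hr
  have hr0 : 0 ≤ r := phaseStart_nonneg M i
  set h := halfPhase M i with hh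
  have hh0 : (0 : ℝ) < h := by exact_mod_cast halfPhase_pos M i
  -- `K` exceeds every part of the offline cost that does not grow with the stream. What remains is
  -- `N * K` for the unit jobs and `K` for the delayed long job.
  set K : ℕ := ⌈(L.map PlacedJob.response).sum + (3 * h + N * h + α)⌉₊ + 1 with hK
  have hK1 : (L.map PlacedJob.response).sum + (3 * h + N * h + α) ≤ K := by
    rw [hK, Nat.cast_add]
    have := Nat.le_ceil ((L.map PlacedJob.response).sum + (3 * h + N * h + α))
    push_cast
    linarith
  -- The long job, postponed until the stream ends at `r + h + K`, finishes at `D`. The big job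
  -- released then only fixes `α` and `β`.
  set D : ℝ := r + 3 * h + K with hD
  have hD0 : 0 ≤ D := by positivity
  obtain ⟨hs1, hs2⟩ := pairwise_phases (N := N) hi
  have hround : ∀ J ∈ rounds N r hr0 (h + K), r ≤ J.release ∧ J.release ≤ D := by
    intro J hJ
    have := release_le_of_mem_rounds hJ
    push_cast at this
    exact ⟨le_release_of_mem_rounds hJ, by linarith⟩
  let ω : Instance := ⟨(phases N M i ++ [longJob M i]) ++ (rounds N r hr0 (h + K) ++
    [Job.big α β D hα0 hβ hD0]), by simp, by
      simp only [List.pairwise_append, List.mem_append, List.mem_singleton]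
      refine ⟨⟨hs1, by simp, ?_⟩, ⟨pairwise_rounds, by simp, ?_⟩, ?_⟩
      · rintro J hJ _ rfl
        exact hs2 J hJ
      · rintro J hJ _ rfl
        exact (hround J hJ).2
      · rintro J hJ J' hJ'
        have h1 : J.release ≤ r := by
          rcases hJ with hJ | rfl
          · exact hs2 J hJ
          · exact le_rfl
        rcases hJ' with hJ' | rfl
        · exact h1.trans (hround J' hJ').1
        · simp only [Job.big_release]
          have : (0 : ℝ) ≤ K := Nat.cast_nonneg _
          linarith⟩
  obtain ⟨h1, h2⟩ := alpha_eq_and_beta_eq (ω := ω) hα hβ0 hβ hD0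
    ⟨_, _, by
      simp only [ω, List.mem_append]
      exact Or.inr (Or.inl (mem_rounds.2 ⟨0, Nat.mul_pos (by omega) (by omega), rfl⟩))⟩
    (by simp [ω]) (by
      intro J hJ
      simp only [ω, List.mem_append, List.mem_singleton] at hJ
      rcases hJ with (hJ | rfl) | hJ | rfl
      · obtain ⟨p, r, hp, hr, rfl, h3, h4⟩ := eq_single_of_mem_phases hJ
        exact Or.inr ⟨p, r, hp, hr, rfl, h3, h4.trans hM⟩
      · obtain ⟨p, r, hp, hr, h5, h3, h4⟩ := eq_single_of_mem_phases
          (List.mem_of_getElem? (getElem?_length_phases N M (Nat.lt_succ_self i)))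
        exact Or.inr ⟨p, r, hp, hr, h5, h3, h4.trans hM⟩
      · obtain ⟨q, -, rfl⟩ := mem_rounds.1 hJ
        exact Or.inr ⟨_, _, _, _, rfl, le_rfl, hα⟩
      · exact Or.inl rfl)
  refine ⟨K, ω, Job.big α β D hα0 hβ hD0, rfl, ?_, h1, h2, ?_⟩
  · simp only [Job.big_release]
    have : (0 : ℝ) ≤ K := Nat.cast_nonneg _
    linarith
  have hN0 : 0 < N := by omega
  have hKr : (0 : ℝ) ≤ K := Nat.cast_nonneg _
  have hfinl : (⟨longJob M i, ⟨0, hN0⟩, r + h + K⟩ : PlacedJob N).finish = D := by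
    simp only [PlacedJob.finish, longJob, Job.single_workload, hD, ← hh]
    ring
  have hopt := PlacedJob.opt_le (N := N) par (ω := ω)
    (L := (L ++ [⟨longJob M i, ⟨0, hN0⟩, r + h + K⟩]) ++ (roundsPlaced N hN0 r hr0 (h + K) ++
      [⟨Job.big α β D hα0 hβ hD0, ⟨0, hN0⟩, D⟩])) (by
      simp only [List.pairwise_append, List.mem_append, List.mem_singleton]
      refine ⟨⟨hcomp, by simp, ?_⟩, ⟨pairwise_roundsPlaced, by simp, ?_⟩, ?_⟩
      · rintro P hP _ rfl _
        left
        have := (hfin P hP).2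
        simp only
        linarith
      · rintro P hP _ rfl _
        left
        have := (mem_roundsPlaced hP).2.2
        push_cast at this
        simp only
        linarith
      · rintro P (hP | rfl) Q (hQ | rfl) _
        · exact Or.inl ((hfin P hP).2.trans (mem_roundsPlaced hQ).2.1)
        · left
          have := (hfin P hP).2
          simp only
          linarith
        · right
          have := (mem_roundsPlaced hQ).2.2
          push_cast at this
          simp only
          linarith
        · left
          rw [hfinl]) (by
      simp [ω, map_roundsPlaced, hL]) (by
      intro P hP
      simp only [List.mem_append, List.mem_singleton] at hP
      rcases hP with (hP | rfl) | hP | rfl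
      · exact (hfin P hP).1
      · simp only [longJob, Job.single_release]
        linarith
      · exact (mem_roundsPlaced hP).1.le
      · exact le_rfl)
  refine hopt.trans ?_
  simp only [List.map_append, List.sum_append, sum_response_roundsPlaced, List.map_cons,
    List.map_nil, List.sum_cons, List.sum_nil, add_zero]
  rw [PlacedJob.response, PlacedJob.response, hfinl]
  simp only [PlacedJob.finish, longJob, Job.single_release, Job.big_release, Job.big_workload]
  push_cast
  linarith

/-! ### The lower bound in `log α` -/

namespace OnlineAlgorithm

variable {N : ℕ} {par : Prop}

/-- Either the algorithm spends much time on a long job during the first half of some phase, and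
then it has many unfinished unit jobs, or it has many unfinished long jobs after all phases. -/
theorem le_competitiveRatio_of_phases (hN : 2 ≤ N) (A : OnlineAlgorithm N par) {α β : ℝ}
    (hα : 1 ≤ α) (hβ0 : 0 ≤ β) (hβ : β ≤ α) {I : ℕ} (hI : 2 * 4 ^ (2 * I + 1) ≤ α) :
    ENNReal.ofReal (I / (N + 2)) ≤ A.competitiveRatio α β := by
  -- This makes `halfPhase M i ≥ 4 ^ (I + 2)` for `i < I`, hence a third of it is at least `I + 1`.
  set M := 2 * I + 1 with hM
  have hN0 : 0 < N := by omega
  have hex := fun (i : ℕ) (hi : i ≤ M) => exists_hard_instance hN par hα hβ0 hβ hI hi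
  have : Nonempty Job := ⟨longJob 0 0⟩
  have : Nonempty Instance := ⟨⟨[longJob 0 0], by simp, by simp⟩⟩
  choose! K ω big hω hbig hωα hωβ hopt using hex
  suffices h : ∃ i ≤ M, (K i : ℝ) * I ≤ (A.schedule (ω i)).cost (ω i) by
    obtain ⟨i, hi, hcost⟩ := h
    refine A.le_competitiveRatio (hωα i hi) (hωβ i hi) hcost (hopt i hi) (le_of_eq ?_)
      (by positivity)
    field_simp
  have hlong : ∀ i, ∃ hp, (longJob M i).tasks[0]? = some ⟨2 * halfPhase M i, hp, true⟩ :=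
    fun i => ⟨_, rfl⟩
  have hrounds : ∀ i ≤ M, ∀ q < N * (halfPhase M i + K i), ∃ J τ,
      (ω i).IsTask ((phases N M i).length + 1 + q) 0 J τ ∧ τ.size = 1 ∧
        J.release = phaseStart M i + (q / N : ℕ) := by
    intro i hi q hq
    have := isTask_of_jobs_eq (hω i hi) hq
    rwa [List.length_append, List.length_singleton] at this
  by_cases hcase : ∃ i < I, (I : ℝ) ≤
      (A.schedule (ω i)).work (phases N M i).length 0 (phaseStart M i + halfPhase M i) -
        (A.schedule (ω i)).work (phases N M i).length 0 (phaseStart M i)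
  · obtain ⟨i, hi, hwork⟩ := hcase
    have hiM : i ≤ M := by omega
    refine ⟨i, hiM, ?_⟩
    have := (A.feasible (ω i)).mul_le_cost_of_rounds hN0 (Nat.le_add_right _ _)
      (hrounds i hiM) ∅ (by simp) (Nat.lt_succ_self _) (by simp) (by simpa using hwork)
    simpa using this
  · push Not at hcase
    have hIM : I ≤ M := by omega
    refine ⟨I, hIM, ?_⟩
    have hmono := length_phases_strictMono N M
    have hfeas := A.feasible (ω I)
    have htask : ∀ i < I, ∃ hp, (ω I).IsTask (phases N M i).length 0 (longJob M i)
        ⟨2 * halfPhase M i, hp, true⟩ := by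
      intro i hi
      obtain ⟨hp, h⟩ := hlong i
      refine ⟨hp, ?_, h⟩
      rw [hω I hIM, List.append_assoc, List.getElem?_append_left (hmono hi)]
      exact getElem?_length_phases N M hi
    have hrem : ∀ i < I, (1 : ℝ) ≤ 2 * halfPhase M i -
        (A.schedule (ω I)).work (phases N M i).length 0 (phaseStart M I) := by
      intro i hi
      have hiM : i ≤ M := by omega
      obtain ⟨hp, hti⟩ := htask i hi
      have hsucc := phaseStart_succ (show i < M by omega)
      have hh : (0 : ℝ) < halfPhase M i := by exact_mod_cast halfPhase_pos M i
      -- The instances for `I` and `i` share everything through the first half of phase `i`, so the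
      -- bound on work transfers to the former.
      have hagree : ∀ t < phaseStart M i + halfPhase M i,
          A.schedule (ω I) t = A.schedule (ω i) t := by
        intro t ht
        obtain ⟨L₁, hL₁, hr₁⟩ := exists_phases_eq_append N M (show i + 1 ≤ I from hi)
        obtain ⟨L₂, hL₂, hr₂⟩ := rounds_add N (phaseStart M i) (phaseStart_nonneg M i)
          (halfPhase M i) (K i)
        have hm := phaseStart_mono M (show i + 1 ≤ I from hi)
        have hb := hbig I hIM
        have hI0 : (0 : ℝ) ≤ halfPhase M I := Nat.cast_nonneg _
        refine A.causal _ _ t (revealed_append (L := phases N M (i + 1))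
          (L₁ := L₁ ++ ([longJob M I] ++ (rounds N (phaseStart M I) (phaseStart_nonneg M I)
            (halfPhase M I + K I) ++ [big I]))) (L₂ := L₂ ++ [big i]) ?_ ?_ ?_ ?_)
        · rw [hω I hIM, hL₁]
          simp
        · rw [hω i hiM, hL₂, phases_succ]
          simp
        · intro J hJ
          simp only [List.mem_append, List.mem_singleton] at hJ
          rcases hJ with hJ | rfl | hJ | rfl
          · have := hr₁ J hJ
            linarith
          · simp only [longJob, Job.single_release]
            linarith
          · have := le_release_of_mem_rounds hJ
            linarith
          · linarith
        · intro J hJ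
          simp only [List.mem_append, List.mem_singleton] at hJ
          rcases hJ with hJ | rfl
          · exact ht.trans_le (hr₂ J hJ)
          · exact ht.trans_le (hbig i hiM)
      have h1 := hcase i hi
      rw [← Schedule.work_congr hagree,
        ← Schedule.work_congr (fun t ht => hagree t (ht.trans (by linarith))),
        hfeas.work_eq_zero hti (t := phaseStart M i) le_rfl] at h1
      -- Even if served throughout the remaining `5 / 3 * h`, the long job keeps at least `2 * h - I
      -- - 5 / 3 * h = h / 3 - I ≥ 1` unit.
      have hend : phaseStart M I ≤ phaseStart M i + 8 / 3 * halfPhase M i := by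
        have : (0 : ℝ) ≤ halfPhase M I := Nat.cast_nonneg _
        unfold phaseStart
        linarith
      have hle : phaseStart M i + halfPhase M i ≤ phaseStart M I := by
        have := phaseStart_mono M (show i + 1 ≤ I from hi)
        linarith
      have h2 := hfeas.work_sub_le (phases N M i).length 0 hle
      have hbound : 3 * (I + 1) ≤ halfPhase M i := by
        have h3 : I + 1 < 4 ^ (I + 1) := Nat.lt_pow_self (by norm_num)
        have h4 : 4 ^ (I + 1 + 1) ≤ halfPhase M i := Nat.pow_le_pow_right (by norm_num) (by omega)
        rw [pow_succ] at h4
        omega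
      have hbound' : 3 * ((I : ℝ) + 1) ≤ halfPhase M i := by exact_mod_cast hbound
      linarith
    -- The backlog consists of the earlier long jobs alone; the long job of phase `I` is a dummy
    -- `j₀`, contributing nothing as `a = 0`.
    have hcost := hfeas.mul_le_cost_of_rounds (V := I) (a := 0) hN0 (Nat.zero_le _)
      (hrounds I hIM) ((Finset.range I).image fun i => (phases N M i).length) (by
        intro j hj
        obtain ⟨i, hi, rfl⟩ := Finset.mem_image.1 hj
        rw [Finset.mem_range] at hi
        obtain ⟨hp, hti⟩ := htask i hi
        exact ⟨(hmono hi).trans (Nat.lt_succ_self _), _, _, hti, phaseStart_mono M hi.le,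
          hrem i hi⟩) (Nat.lt_succ_self _) (by
        intro hj
        obtain ⟨i, hi, hij⟩ := Finset.mem_image.1 hj
        exact (Finset.mem_range.1 hi).ne (hmono.injective hij)) (by
        rw [Finset.card_image_of_injective _ hmono.injective]
        simp)
    refine le_trans (mul_le_mul_of_nonneg_right ?_ (Nat.cast_nonneg _)) hcost
    push_cast
    linarith [(Nat.cast_nonneg (halfPhase M I) : (0 : ℝ) ≤ _)]

theorem mul_log_le_competitiveRatio (hN : 2 ≤ N) (A : OnlineAlgorithm N par) {α β : ℝ}
    (hα : 1 ≤ α) (hβ0 : 0 ≤ β) (hβ : β ≤ α) :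
    ENNReal.ofReal (1 / (12 * (N + 2)) * Real.log α) ≤ A.competitiveRatio α β := by
  have hN0 : (0 : ℝ) ≤ N := Nat.cast_nonneg _
  rcases le_total (Real.log α) 12 with h | h
  · refine le_trans (ENNReal.ofReal_le_ofReal ?_) (A.one_le_competitiveRatio_of_le hα hβ0 hβ)
    rw [one_div, inv_mul_le_iff₀ (by positivity)]
    linarith
  -- The long jobs fit since `(4 * I + 3) * log 2 ≤ 6 * I ≤ log α`, and `log α ≥ 12` gives `I ≥ log
  -- α / 12`.
  · set I := ⌊Real.log α / 6⌋₊ with hI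
    have hI1 : (I : ℝ) ≤ Real.log α / 6 := Nat.floor_le (by linarith)
    have hI2 : Real.log α / 6 < I + 1 := Nat.lt_floor_add_one _
    have hpow : (2 : ℝ) * 4 ^ (2 * I + 1) ≤ α := by
      have h2 : (2 : ℝ) * 4 ^ (2 * I + 1) = 2 ^ (4 * I + 3) := by
        rw [show (4 : ℝ) = 2 ^ 2 by norm_num, ← pow_mul, ← pow_succ']
        congr 1
        ring
      rw [h2, ← Real.log_le_log_iff (by positivity) (by linarith), Real.log_pow]
      have := Real.log_two_lt_d9
      have h3 : (1 : ℝ) ≤ I := by linarith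
      push_cast
      nlinarith
    refine le_trans (ENNReal.ofReal_le_ofReal ?_) (A.le_competitiveRatio_of_phases hN hα hβ0 hβ hpow)
    rw [div_mul_eq_mul_div, div_le_div_iff₀ (by positivity) (by positivity)]
    have : 0 ≤ (N + 2) * ((I : ℝ) - Real.log α / 12) := mul_nonneg (by linarith) (by linarith)
    nlinarith

end OnlineAlgorithm

end MultitaskScheduling

theorem mainTheorem6 (N : ℕ) (hN : 1 ≤ N) (par : Prop) :
    (¬ ∃ A : MultitaskScheduling.OnlineAlgorithm N par, A.IsLittleOCompetitive) ∧
    (∃ c : ℝ, 0 < c ∧ ∀ (A : MultitaskScheduling.OnlineAlgorithm N par) (α β : ℝ),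
      1 ≤ α → 0 ≤ β → β ≤ α →
        ENNReal.ofReal (c * β) ≤ A.competitiveRatio α β) ∧
    (2 ≤ N → ∃ c : ℝ, 0 < c ∧ ∀ (A : MultitaskScheduling.OnlineAlgorithm N par) (α β : ℝ),
      1 ≤ α → 0 ≤ β → β ≤ α →
        ENNReal.ofReal (c * (Real.log α + β)) ≤ A.competitiveRatio α β) := by
  refine ⟨fun ⟨A, hA⟩ => A.not_isLittleOCompetitive hN hA,
    ⟨1 / (4 * (N + 3)), by positivity, fun A α β hα hβ0 hβ =>
      A.mul_beta_le_competitiveRatio hN hα hβ0 hβ⟩, fun hN2 => ?_⟩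
  set c₁ : ℝ := 1 / (12 * (N + 2)) with hc₁
  set c₂ : ℝ := 1 / (4 * (N + 3)) with hc₂
  have h1 : 0 < c₁ := by positivity
  have h2 : 0 < c₂ := by positivity
  -- Half the sum of the two bounds is at most the larger one.
  refine ⟨min c₁ c₂ / 2, by positivity, fun A α β hα hβ0 hβ => ?_⟩
  have hlog : 0 ≤ Real.log α := Real.log_nonneg hα
  have h3 : min c₁ c₂ * Real.log α ≤ c₁ * Real.log α :=
    mul_le_mul_of_nonneg_right (min_le_left _ _) hlog
  have h4 : min c₁ c₂ * β ≤ c₂ * β := mul_le_mul_of_nonneg_right (min_le_right _ _) hβ0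
  rcases le_total (c₁ * Real.log α) (c₂ * β) with h | h
  · exact le_trans (ENNReal.ofReal_le_ofReal (by linarith))
      (A.mul_beta_le_competitiveRatio hN hα hβ0 hβ)
  · exact le_trans (ENNReal.ofReal_le_ofReal (by linarith))
      (A.mul_log_le_competitiveRatio hN2 hα hβ0 hβ)
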